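/- **Setting.** Let $X$ be a real reflexive Banach space and let $b:X\to\,]-\infty,\infty]$ be a semi-Bregman function: $b$ is convex and lower semicontinuous, strictly convex on $\mathrm{dom}(b)=\{b<\infty\}$, the zone $U:=\mathrm{Int}(\mathrm{dom}(b))$ is nonempty, and $b$ is Gâteaux differentiable on $U$ with gradient $b'$. Put $B(x,y):=b(x)-b(y)-\langle b'(y),x-y\rangle$ for $x\in\mathrm{dom}(b)$, $y\in U$, and $B(x,y):=\infty$ otherwise. Let $C\subseteq\mathrm{dom}(b)$ be closed and convex, contain more than one point, and satisfy $C\cap U\ne\emptyset$. Let $f:\mathrm{dom}(b)\to\mathbb R$ be convex, Gâteaux differentiable on $U$ and such that $f|_C$ is lower semicontinuous; let $g:C\to\,]-\infty,\infty]$ be convex, proper and lower semicontinuous. Put $F:=f+g$ on $C$, $F:=\infty$ off $C$, and let $\mathrm{MIN}(F)$ be the set of minimizers of $F$ over $C$; assume $\emptyset\neq\mathrm{MIN}(F)\subseteq U$. For $\mu>0$, $b$ is called strongly convex on $S\subseteq\mathrm{dom}(b)$ with parameter $\mu$ if $b(\lambda x+(1-\lambda)y)+\frac12\mu\lambda(1-\lambda)\|x-y\|^2\le\lambda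 b(x)+(1-\lambda)b(y)$ for all $x,y\in S$, $\lambda\in]0,1[$. For nonempty $S_1,S_2\subseteq\mathrm{dom}(b)$, $b$ is called uniformly convex relative to $(S_1,S_2)$ with gauge $\psi:[0,\infty[\,\to[0,\infty]$ if $\psi(t)>0$ for $t>0$ and $b(\lambda x+(1-\lambda)y)+\lambda(1-\lambda)\psi(\|x-y\|)\le\lambda b(x)+(1-\lambda)b(y)$ for all $x\in S_1$, $y\in S_2$, $\lambda\in]0,1[$; it is uniformly convex on $S$ if this holds for $S_1=S_2=S$ and some gauge. For $L,\mu>0$ and $y\in U$ put $Q_{L,\mu}(x,y):=f(y)+\langle f'(y),x-y\rangle+\frac L\mu B(x,y)+g(x)$, and let $p_{L,\mu,S}(y)$ denote the minimizer of $Q_{L,\mu}(\cdot,y)$ over $S$. For $T\subseteq U$ let $L(f',T)\in[0,\infty]$ be the best Lipschitz constant of $f'$ on $T$. A *telescopic sequence with parameters* $(\mu_k)_{k\ge1}$ is a sequence $(S_k)_{k\ge1}$ of closed convex subsets of $C$ such that $S_k\subseteq S_{k+1}$, $\bigcup_kS_k=C$, $S_k\cap U$ has more than one point, $b$ is strongly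 convex on $S_k$ with parameter $\mu_k>0$, $\mu_{k+1}\le\mu_k$, and $g$ is finite at some point of $S_1$. Consider the two properties (Lip) $f'$ is Lipschitz continuous on $S_k\cap U$ for every $k\geq 1$; (Prox) $p_{L,\mu_k,S_k}(y)\in S_k\cap U$ for all $L>0$, $k\ge1$ and $y\in S_k\cap U$. Assume that (Prox) holds for every telescopic sequence which satisfies (Lip) and for which $g$ is finite at some point of $S_1\cap U$, or that at least one telescopic sequence satisfying both (Lip) and (Prox) is given. *TEPROG, Lipschitz rule*: $x_1\in S_1\cap U$, $0<L_1$, $L(f',S_1\cap U)\le L_1$, and for $k\ge2$, $L_k\ge\max\{L_{k-1},L(f',S_k\cap U)\}$ and $x_k=p_{L_k,\mu_k,S_k}(x_{k-1})$. *TEPROG, backtracking rule* (with $\eta>1$): $x_1\in S_1\cap U$, $L_1>0$, where also $L_1\le\eta L(f',S_1\cap U)$ unless $S_k=C$ for all $k$; for $k\ge2$, $L_k=\eta^{i_k}L_{k-1}$, where $i_k\ge0$ is the smallest integer for which $z=p_{L_k,\mu_k,S_k}(x_{k-1})$ satisfies $F(z)\le Q_{L_k,\mu_k}(z,x_{k-1})$,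 and $x_k=p_{L_k,\mu_k,S_k}(x_{k-1})$. **Statement.** Assume in addition that $f''$ (the Gâteaux derivative of $f':U\to X^*$) exists on $C\cap U$ and is bounded and uniformly continuous on bounded subsets of $C\cap U$, and that $b$ is strongly convex on $C$ with parameter $\mu>0$. Let $q\in]0,1[$, $y_0\in C\cap U$ and $\alpha>\|f''(y_0)\|$. Then, for the Lipschitz rule, and also for the backtracking rule with any given $\eta>1$, there is a telescopic sequence $(S_k)_{k\ge1}$ with parameters $\mu_k:=\mu$, satisfying (Lip) and (Prox), such that for every initial point $x_1\in S_1\cap U$ there are step parameters $(L_k)$ and a sequence $(x_k)$ starting at $x_1$ and produced by TEPROG with that rule, with the following properties: 1. $\lim_{k\to\infty}F(x_k)=\inf_CF$, and for every $x_{\min}\in\mathrm{MIN}(F)$ there is $k_0\in\mathbb N$ such that $$F(x_{k+1})-F(x_{\min})\le\frac{k+1}{k+1-k_0}\cdot\frac{\alpha\,B(x_{\min},x_{k_0})}{\mu\,(k+1)^{1-q}}\qquad\text{for all }k\ge k_0;$$ so the rate of convergence can be made arbitrarily close to $O(1/k)$. 2. If (U) for each $x\in C$ there is $r_x\ge0$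 such that $\{y\in U:\|y\|\ge r_x\}\ne\emptyset$ and $b$ is uniformly convex relative to $(\{x\},\{y\in U:\|y\|\ge r_x\})$ with a gauge $\psi_x$ satisfying $\lim_{t\to\infty}\psi_x(t)=\infty$, and if $b'$ is weak-to-weak$^*$ sequentially continuous on $U$, then $(x_k)$ converges weakly to some point of $\mathrm{MIN}(F)$. Moreover, condition (U) holds whenever $b$ is uniformly convex on $U$. -/

import Mathlib

open Set Filter Topology
open scoped NNReal ENNReal

noncomputable section

namespace TEPROG

/-- `A` is the Gâteaux derivative of `h` at `x`: it is a continuous linear operator which gives all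
the directional derivatives of `h` at `x`. -/
def HasGateauxDerivAt {X Y : Type*} [NormedAddCommGroup X] [NormedSpace ℝ X]
    [NormedAddCommGroup Y] [NormedSpace ℝ Y] (h : X → Y) (A : X →L[ℝ] Y) (x : X) : Prop :=
  ∀ v : X, HasLineDerivAt ℝ h (A v) x v

/-- Reflexivity: the canonical embedding into the double dual is onto. -/
def IsReflexive (X : Type*) [NormedAddCommGroup X] [NormedSpace ℝ X] : Prop :=
  Function.Surjective (NormedSpace.inclusionInDoubleDual ℝ X)

/-- Weak convergence of a sequence. -/
def WeaklyTendsto {X : Type*} [NormedAddCommGroup X] [NormedSpace ℝ X] (x : ℕ → X) (z : X) :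
    Prop :=
  ∀ φ : X →L[ℝ] ℝ, Tendsto (fun k => φ (x k)) atTop (𝓝 (φ z))

/-- Weak-to-weak* sequential continuity on a set `S` of a map into the dual. -/
def WeakToWeakStarSeqContinuousOn {X : Type*} [NormedAddCommGroup X] [NormedSpace ℝ X]
    (h : X → X →L[ℝ] ℝ) (S : Set X) : Prop :=
  ∀ (y : ℕ → X) (z : X), (∀ i, y i ∈ S) → z ∈ S → WeaklyTendsto y z →
    ∀ w : X, Tendsto (fun i => h (y i) w) atTop (𝓝 (h z w))

/-- The effective domain of an extended real-valued function. -/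
def dom {X : Type*} (b : X → EReal) : Set X := {x | b x < ⊤}

/-- The zone `U`: the interior of the effective domain. -/
def zone {X : Type*} [TopologicalSpace X] (b : X → EReal) : Set X := interior (dom b)

/-- Convexity on a set of a function with values in `]-∞, ∞]` (the set itself is assumed to be
convex separately). -/
def EConvexOn {X : Type*} [AddCommGroup X] [Module ℝ X] (S : Set X) (h : X → EReal) : Prop :=
  ∀ x ∈ S, ∀ y ∈ S, ∀ l : ℝ, 0 < l → l < 1 →
    h (l • x + (1 - l) • y) ≤ (l : EReal) * h x + ((1 - l : ℝ) : EReal) * h y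

/-- Strict convexity on a set. -/
def EStrictConvexOn {X : Type*} [AddCommGroup X] [Module ℝ X] (S : Set X) (h : X → EReal) :
    Prop :=
  ∀ x ∈ S, ∀ y ∈ S, x ≠ y → ∀ l : ℝ, 0 < l → l < 1 →
    h (l • x + (1 - l) • y) < (l : EReal) * h x + ((1 - l : ℝ) : EReal) * h y

/-- `b` is strongly convex on `S` with parameter `μ`. -/
def StronglyConvexOn {X : Type*} [NormedAddCommGroup X] [NormedSpace ℝ X] (S : Set X)
    (b : X → EReal) (μ : ℝ) : Prop :=
  0 < μ ∧ ∀ x ∈ S, ∀ y ∈ S, ∀ l : ℝ, 0 < l → l < 1 →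
    b (l • x + (1 - l) • y) + ((l * (1 - l) * (1 / 2 * μ * ‖x - y‖ ^ 2) : ℝ) : EReal)
      ≤ (l : EReal) * b x + ((1 - l : ℝ) : EReal) * b y

/-- `b` is uniformly convex relative to `(S₁, S₂)` with relative gauge `ψ`. -/
def IsRelativeGauge {X : Type*} [NormedAddCommGroup X] [NormedSpace ℝ X] (b : X → EReal)
    (S₁ S₂ : Set X) (ψ : ℝ≥0 → ℝ≥0∞) : Prop :=
  (∀ t, 0 < t → 0 < ψ t) ∧
  ∀ x ∈ S₁, ∀ y ∈ S₂, ∀ l : ℝ, 0 < l → l < 1 →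
    b (l • x + (1 - l) • y) + ((l * (1 - l) : ℝ) : EReal) * ((ψ ‖x - y‖₊ : ℝ≥0∞) : EReal)
      ≤ (l : EReal) * b x + ((1 - l : ℝ) : EReal) * b y

/-- `b` is uniformly convex on `S`. -/
def UniformlyConvexOn {X : Type*} [NormedAddCommGroup X] [NormedSpace ℝ X] (S : Set X)
    (b : X → EReal) : Prop :=
  ∃ ψ : ℝ≥0 → ℝ≥0∞, IsRelativeGauge b S S ψ

/-- For each `x ∈ C` there is `r ≥ 0` such that `{y ∈ U : ‖y‖ ≥ r}` is nonempty and `b` is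
uniformly convex relative to `({x}, {y ∈ U : ‖y‖ ≥ r})` with a gauge tending to `∞` at `∞`. -/
def RelativelyUniformlyConvexFromPoints {X : Type*} [NormedAddCommGroup X] [NormedSpace ℝ X]
    (b : X → EReal) (C : Set X) : Prop :=
  ∀ x ∈ C, ∃ r : ℝ, 0 ≤ r ∧ {y | y ∈ zone b ∧ r ≤ ‖y‖}.Nonempty ∧
    ∃ ψ : ℝ≥0 → ℝ≥0∞, IsRelativeGauge b {x} {y | y ∈ zone b ∧ r ≤ ‖y‖} ψ ∧
      Tendsto ψ atTop (𝓝 ⊤)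

/-- `b : X → ]-∞, ∞]` is a semi-Bregman function with zone `U = Int(dom b)` and `b'` is its
Gâteaux derivative on the zone (the values of `b'` outside the zone play no role). -/
structure IsSemiBregman {X : Type*} [NormedAddCommGroup X] [NormedSpace ℝ X] (b : X → EReal)
    (b' : X → X →L[ℝ] ℝ) : Prop where
  ne_bot : ∀ x, b x ≠ ⊥
  zone_nonempty : (zone b).Nonempty
  gateaux : ∀ x ∈ zone b, HasGateauxDerivAt (fun y => (b y).toReal) (b' x) x
  convex : EConvexOn univ b
  lsc : LowerSemicontinuous b
  strict : EStrictConvexOn (dom b) b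

open Classical in
/-- The Bregman divergence `B(x, y)` of `b`. -/
def bregman {X : Type*} [NormedAddCommGroup X] [NormedSpace ℝ X] (b : X → EReal)
    (b' : X → X →L[ℝ] ℝ) (x y : X) : EReal :=
  if x ∈ dom b ∧ y ∈ zone b then b x - b y - ((b' y (x - y) : ℝ) : EReal) else ⊤

open Classical in
/-- The objective function: `F = f + g` on `C` and `F = ∞` outside `C`. -/
def objective {X : Type*} (C : Set X) (f : X → ℝ) (g : X → EReal) (x : X) : EReal :=
  if x ∈ C then (f x : EReal) + g x else ⊤

/-- `MIN(F)`: the set of minimizers of `F` over `C`. -/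
def minimizers {X : Type*} (C : Set X) (f : X → ℝ) (g : X → EReal) : Set X :=
  {x | x ∈ C ∧ IsMinOn (objective C f g) C x}

/-- `Q_{L,μ}(x, y) = f(y) + ⟨f'(y), x - y⟩ + (L/μ) B(x, y) + g(x)`. -/
def proxModel {X : Type*} [NormedAddCommGroup X] [NormedSpace ℝ X] (b : X → EReal)
    (b' : X → X →L[ℝ] ℝ) (f : X → ℝ) (f' : X → X →L[ℝ] ℝ) (g : X → EReal) (L μ : ℝ) (x y : X) :
    EReal :=
  ((f y + f' y (x - y) : ℝ) : EReal) + ((L / μ : ℝ) : EReal) * bregman b b' x y + g x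

/-- `z = p_{L,μ,S}(y)`: the point `z` minimizes `Q_{L,μ}(·, y)` over `S`. -/
def IsProxPoint {X : Type*} [NormedAddCommGroup X] [NormedSpace ℝ X] (b : X → EReal)
    (b' : X → X →L[ℝ] ℝ) (f : X → ℝ) (f' : X → X →L[ℝ] ℝ) (g : X → EReal) (L μ : ℝ) (S : Set X)
    (y z : X) : Prop :=
  z ∈ S ∧ IsMinOn (fun x => proxModel b b' f f' g L μ x y) S z

/-- A telescopic sequence `(S_k)_{k ≥ 1}` in `C`, with strong convexity parameters `μ_k` of `b`
(the index `0` plays no role). -/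
structure IsTelescopic {X : Type*} [NormedAddCommGroup X] [NormedSpace ℝ X] (b : X → EReal)
    (g : X → EReal) (C : Set X) (S : ℕ → Set X) (μ : ℕ → ℝ) : Prop where
  closed : ∀ k, 1 ≤ k → IsClosed (S k)
  convex : ∀ k, 1 ≤ k → Convex ℝ (S k)
  nontrivial : ∀ k, 1 ≤ k → (S k ∩ zone b).Nontrivial
  mono : ∀ k, 1 ≤ k → S k ⊆ S (k + 1)
  strong : ∀ k, 1 ≤ k → StronglyConvexOn (S k) b (μ k)
  param : ∀ k, 1 ≤ k → μ (k + 1) ≤ μ k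
  union : ⋃ k ∈ Ici 1, S k = C
  proper : ∃ x ∈ S 1, g x < ⊤

/-- `f'` is Lipschitz continuous on each `S_k ∩ U`. -/
def LipschitzOnPieces {X : Type*} [NormedAddCommGroup X] [NormedSpace ℝ X] (b : X → EReal)
    (f' : X → X →L[ℝ] ℝ) (S : ℕ → Set X) : Prop :=
  ∀ k, 1 ≤ k → ∃ K : ℝ≥0, LipschitzOnWith K f' (S k ∩ zone b)

/-- For all `L > 0`, `k ≥ 1` and `y ∈ S_k ∩ U`, one has `p_{L,μ_k,S_k}(y) ∈ S_k ∩ U`. -/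
def ProxInZone {X : Type*} [NormedAddCommGroup X] [NormedSpace ℝ X] (b : X → EReal)
    (b' : X → X →L[ℝ] ℝ) (f : X → ℝ) (f' : X → X →L[ℝ] ℝ) (g : X → EReal)
    (S : ℕ → Set X) (μ : ℕ → ℝ) : Prop :=
  ∀ L : ℝ, 0 < L → ∀ k, 1 ≤ k → ∀ y ∈ S k ∩ zone b, ∀ z,
    IsProxPoint b b' f f' g L (μ k) (S k) y z → z ∈ S k ∩ zone b

/-- `L(f', T)`: the best Lipschitz constant of `f'` on `T`, as a number in `[0, ∞]`. -/
def bestLip {X : Type*} [NormedAddCommGroup X] [NormedSpace ℝ X] (f' : X → X →L[ℝ] ℝ)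
    (T : Set X) : ℝ≥0∞ :=
  ⨆ (x ∈ T) (y ∈ T) (_ : x ≠ y), ENNReal.ofReal (‖f' x - f' y‖ / ‖x - y‖)

/-- `(L_k)` and `(x_k)`, `k ≥ 1`, are produced by TEPROG with the Lipschitz step size rule. -/
structure IsLipschitzRun {X : Type*} [NormedAddCommGroup X] [NormedSpace ℝ X] (b : X → EReal)
    (b' : X → X →L[ℝ] ℝ) (f : X → ℝ) (f' : X → X →L[ℝ] ℝ) (g : X → EReal)
    (S : ℕ → Set X) (μ : ℕ → ℝ) (L : ℕ → ℝ) (x : ℕ → X) : Prop where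
  L_pos : 0 < L 1
  L_one : bestLip f' (S 1 ∩ zone b) ≤ ENNReal.ofReal (L 1)
  start : x 1 ∈ S 1 ∩ zone b
  L_mono : ∀ k, 1 ≤ k → L k ≤ L (k + 1)
  L_lip : ∀ k, 1 ≤ k → bestLip f' (S (k + 1) ∩ zone b) ≤ ENNReal.ofReal (L (k + 1))
  step : ∀ k, 1 ≤ k →
    IsProxPoint b b' f f' g (L (k + 1)) (μ (k + 1)) (S (k + 1)) (x k) (x (k + 1))

/-- `(L_k)` and `(x_k)`, `k ≥ 1`, are produced by TEPROG with the backtracking step size rule with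
parameter `η`. In `step`, `i` is the smallest nonnegative integer such that, with
`L_{k+1} = η ^ i * L_k`, the point `z = p_{L_{k+1},μ_{k+1},S_{k+1}}(x_k)` satisfies
`F(z) ≤ Q_{L_{k+1},μ_{k+1}}(z, x_k)`. -/
structure IsBacktrackingRun {X : Type*} [NormedAddCommGroup X] [NormedSpace ℝ X]
    (b : X → EReal) (b' : X → X →L[ℝ] ℝ) (f : X → ℝ) (f' : X → X →L[ℝ] ℝ) (g : X → EReal)
    (C : Set X) (η : ℝ) (S : ℕ → Set X) (μ : ℕ → ℝ) (L : ℕ → ℝ) (x : ℕ → X) : Prop where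
  L_pos : 0 < L 1
  L_one : (∀ k, 1 ≤ k → S k = C) ∨
    ENNReal.ofReal (L 1) ≤ ENNReal.ofReal η * bestLip f' (S 1 ∩ zone b)
  start : x 1 ∈ S 1 ∩ zone b
  step : ∀ k, 1 ≤ k → ∃ i : ℕ,
    IsLeast {j : ℕ | ∃ z,
      IsProxPoint b b' f f' g (η ^ j * L k) (μ (k + 1)) (S (k + 1)) (x k) z ∧
      objective C f g z ≤ proxModel b b' f f' g (η ^ j * L k) (μ (k + 1)) z (x k)} i ∧
    L (k + 1) = η ^ i * L k ∧
    IsProxPoint b b' f f' g (L (k + 1)) (μ (k + 1)) (S (k + 1)) (x k) (x (k + 1))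

/-- The convergence properties of the iterates `(x_k)_{k ≥ 1}`: the function values converge to the
minimal value; for each minimizer the explicit estimate with constant `α`, parameter `μ` and
exponent `1 - q` holds from some index `k₀` on; and, under the additional assumptions on `b`, the
iterates converge weakly to a minimizer. -/
structure ConvergesAlmostSublinearly {X : Type*} [NormedAddCommGroup X] [NormedSpace ℝ X]
    (b : X → EReal) (b' : X → X →L[ℝ] ℝ) (f : X → ℝ) (g : X → EReal) (C : Set X)
    (μ α q : ℝ) (x : ℕ → X) : Prop where
  values : Tendsto (fun k => objective C f g (x k)) atTop (𝓝 (⨅ y ∈ C, objective C f g y))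
  rate : ∀ xmin ∈ minimizers C f g, ∃ k₀ : ℕ, 1 ≤ k₀ ∧ ∀ k : ℕ, k₀ ≤ k →
    objective C f g (x (k + 1)) - objective C f g xmin ≤
      ((((k : ℝ) + 1) / ((k : ℝ) + 1 - (k₀ : ℝ)) * (α / (μ * ((k : ℝ) + 1) ^ (1 - q))) : ℝ) :
        EReal) * bregman b b' xmin (x k₀)
  weak : RelativelyUniformlyConvexFromPoints b C →
    WeakToWeakStarSeqContinuousOn b' (zone b) →
    ∃ z ∈ minimizers C f g, WeaklyTendsto x z

end TEPROG

end

/-! Fix a minimizer `w` and write `B` for the divergence of `b`. A proximal step from `x k` to `x (k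
+ 1)` over `S (k + 1)` gives F(x_{k+1}) + (L_{k+1}/μ)(B(w, x_{k+1}) - B(w, x_k)) ≤ F(w) as soon as
`w` lies in `S (k + 1)` (`prox_inequality`). This combines first-order optimality, the three-point
identity, convexity of `f` and the descent test. Division by L_{k+1}/μ makes the right side
telescope. The weights (F(x_k) - F(w)) μ/L_k are nonincreasing, so summation from k₀ yields (k + 1 -
k₀)(F(x_{k+1}) - F(w)) ≤ (L_{k+1}/μ) B(w, x_{k₀}) (`IsDescentRun.rate`).

The rate is thus governed by the growth of the step parameters, and that growth can be prescribed.
Repeating the sets of any telescopic sequence often enough keeps the Lipschitz constants of `f'`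
eventually below any sequence tending to infinity, here α k^q (`exists_slow_index`,
`exists_slow_telescopic`). This is possible for every α > 0. One common parameter μ is available
because `b` is strongly convex on all of `C`, and a proximal point depends only on L/μ.

Weak convergence is an Opial-type argument. B(z, x_k) converges for each minimizer z, weak cluster
points are minimizers, and for two of them, z and v, the weak continuity of `b'` forces b'(z)(z - v)
= b'(v)(z - v), so that z = v by strong convexity (`exists_weaklyTendsto`).

For the last claim, the least second difference of `b` over pairs of points of the zone at distance
t at least quadruples when t doubles, so it tends to infinity. It serves as a gauge after t is
halved. -/

namespace TEPROG

/-! ### Calculus along lines for Gâteaux derivatives. -/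

section LineDerivatives

variable {X : Type*} [NormedAddCommGroup X] [NormedSpace ℝ X]
  {Y : Type*} [NormedAddCommGroup Y] [NormedSpace ℝ Y]

/-- A lower bound for the difference quotients up to first order errors is a lower bound for the
line derivative. -/
lemma le_of_hasLineDerivAt {h : X → ℝ} {y v : X} {d c e : ℝ} (hd : HasLineDerivAt ℝ h d y v)
    (H : ∀ l : ℝ, 0 < l → l < 1 → l * (c - l * e) ≤ h (y + l • v) - h y) : c ≤ d := by
  have h1 := hd.tendsto_slope_zero_right
  have h2 : Tendsto (fun l : ℝ => c - l * e) (𝓝[>] 0) (𝓝 c) := by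
    have : Tendsto (fun l : ℝ => c - l * e) (𝓝 0) (𝓝 (c - 0 * e)) :=
      (by fun_prop : Continuous fun l : ℝ => c - l * e).tendsto 0
    simpa using this.mono_left nhdsWithin_le_nhds
  refine le_of_tendsto_of_tendsto h2 h1 ?_
  filter_upwards [Ioo_mem_nhdsGT (zero_lt_one (α := ℝ))] with l hl
  have := H l hl.1 hl.2
  rw [smul_eq_mul, ← div_eq_inv_mul, le_div_iff₀ hl.1]
  linarith

/-- The gradient inequality for a (uniformly) convex function along a segment. -/
lemma add_lineDeriv_le {h : X → ℝ} {x y : X} {d c : ℝ} (hd : HasLineDerivAt ℝ h d y (x - y))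
    (H : ∀ l : ℝ, 0 < l → l < 1 →
      h (l • x + (1 - l) • y) + l * (1 - l) * c ≤ l * h x + (1 - l) * h y) :
    h y + d + c ≤ h x := by
  have hd' : HasLineDerivAt ℝ (fun x => -h x) (-d) y (x - y) := HasDerivAt.neg hd
  have := le_of_hasLineDerivAt (c := h y + c - h x) (e := c) hd' (fun l hl hl' => by
    have h1 := H l hl hl'
    have h2 : y + l • (x - y) = l • x + (1 - l) • y := by module
    rw [h2]
    linarith)
  linarith

/-- A translation of the parameter; it makes one-variable calculus on segments available from
Gâteaux differentiability alone. -/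
lemma HasGateauxDerivAt.hasDerivAt_line {h : X → Y} {A : X →L[ℝ] Y} {y v : X} {t : ℝ}
    (hA : HasGateauxDerivAt h A (y + t • v)) :
    HasDerivAt (fun s : ℝ => h (y + s • v)) (A v) t := by
  have h1 : HasDerivAt (fun s : ℝ => h (y + t • v + s • v)) (A v) (t - t) := by
    rw [sub_self]; exact hA v
  have h2 := h1.comp_sub_const t t
  convert h2 using 2 with s
  congr 1
  module

/-- The descent lemma for a Gâteaux differentiable function with Lipschitz continuous gradient. -/
lemma le_of_lipschitz_gradient {f : X → ℝ} {f' : X → X →L[ℝ] ℝ} {S : Set X} (hS : Convex ℝ S)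
    (hf : ∀ x ∈ S, HasGateauxDerivAt f (f' x) x) {K : ℝ}
    (hK : ∀ x ∈ S, ∀ y ∈ S, ‖f' x - f' y‖ ≤ K * ‖x - y‖) {y z : X} (hy : y ∈ S) (hz : z ∈ S) :
    f z ≤ f y + f' y (z - y) + K / 2 * ‖z - y‖ ^ 2 := by
  have hmem : ∀ t ∈ Icc (0 : ℝ) 1, y + t • (z - y) ∈ S := fun t ht =>
    hS.add_smul_sub_mem hy hz ht
  set v := z - y with hv
  -- After subtraction of the linear and quadratic terms the restriction of `f` to the segment has
  -- nonpositive derivative, because (f'(y + tv) - f'(y))v ≤ K t ‖v‖². The claim compares its values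
  -- at 0 and 1.
  have hderiv : ∀ t ∈ Icc (0 : ℝ) 1, HasDerivAt
      (fun s : ℝ => f (y + s • v) - s * f' y v - K / 2 * ‖v‖ ^ 2 * s ^ 2)
      (f' (y + t • v) v - 1 * f' y v - K / 2 * ‖v‖ ^ 2 * (2 * t)) t := fun t ht =>
    (((hf _ (hmem t ht)).hasDerivAt_line.sub ((hasDerivAt_id t).mul_const _)).sub
      ((by simpa using hasDerivAt_pow 2 t : HasDerivAt (fun s : ℝ => s ^ 2) (2 * t) t).const_mul _))
  have hanti := antitoneOn_of_deriv_nonpos (convex_Icc (0 : ℝ) 1)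
    (fun t ht => (hderiv t ht).continuousAt.continuousWithinAt)
    (fun t ht => (hderiv t (interior_subset ht)).differentiableAt.differentiableWithinAt)
    (fun t ht => by
      have ht' := interior_subset ht
      rw [(hderiv t ht').deriv]
      have h1 := hK _ (hmem t ht') _ hy
      rw [add_sub_cancel_left, norm_smul, Real.norm_of_nonneg ht'.1] at h1
      have h2 : f' (y + t • v) v - f' y v ≤ ‖f' (y + t • v) - f' y‖ * ‖v‖ := by
        exact (le_abs_self _).trans ((f' (y + t • v) - f' y).le_opNorm v)
      have h3 := mul_le_mul_of_nonneg_right h1 (norm_nonneg v)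
      nlinarith)
  have := hanti (left_mem_Icc.2 zero_le_one) (right_mem_Icc.2 zero_le_one) zero_le_one
  simp only [zero_smul, one_smul, add_zero] at this
  rw [hv, add_sub_cancel] at this
  rw [hv]
  linarith

/-- A function with bounded Gâteaux derivative on a convex set is Lipschitz continuous there. -/
lemma lipschitzOnWith_of_gateaux_bounded {h : X → Y} {h' : X → X →L[ℝ] Y} {S : Set X}
    (hS : Convex ℝ S) (hh : ∀ x ∈ S, HasGateauxDerivAt h (h' x) x) {M : ℝ≥0}
    (hM : ∀ x ∈ S, ‖h' x‖ ≤ M) : LipschitzOnWith M h S := by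
  refine LipschitzOnWith.of_dist_le_mul fun z hz y hy => ?_
  rw [dist_eq_norm, dist_eq_norm]
  have hmem : ∀ t ∈ Icc (0 : ℝ) 1, y + t • (z - y) ∈ S := fun t ht =>
    hS.add_smul_sub_mem hy hz ht
  have := norm_image_sub_le_of_norm_deriv_le_segment_01'
    (f := fun s : ℝ => h (y + s • (z - y))) (f' := fun t => h' (y + t • (z - y)) (z - y))
    (C := M * ‖z - y‖)
    (fun t ht => (hh _ (hmem t ht)).hasDerivAt_line.hasDerivWithinAt)
    (fun t ht => (ContinuousLinearMap.le_opNorm _ _).trans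
      (mul_le_mul_of_nonneg_right (hM _ (hmem t (Ico_subset_Icc_self ht))) (norm_nonneg _)))
  simpa using this

end LineDerivatives

/-! ### Existence of minimizers under strong convexity. -/

section Minimization

variable {X : Type*} [NormedAddCommGroup X] [NormedSpace ℝ X]

/-- A strongly convex function which is bounded below near a point of its domain `D` is bounded
below on `D`. -/
lemma bddBelow_of_stronglyConvex {D : Set X} {ψ : X → ℝ} {m : ℝ} (hm : 0 < m)
    (hD : Convex ℝ D)
    (hψ : ∀ x ∈ D, ∀ y ∈ D, ∀ l : ℝ, 0 < l → l < 1 →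
      ψ (l • x + (1 - l) • y) + l * (1 - l) * (m * ‖x - y‖ ^ 2) ≤ l * ψ x + (1 - l) * ψ y)
    {x₀ : X} (hx₀ : x₀ ∈ D) {r : ℝ} (hr : 0 < r)
    (hnear : ∀ x ∈ D, ‖x - x₀‖ < r → ψ x₀ - 1 ≤ ψ x) : BddBelow (ψ '' D) := by
  -- At distance d ≥ r from `x₀` the estimate below is ψ(x₀) - (2/r + mr/2) d + m d². The second
  -- constant is the minimum of this quadratic in d.
  refine ⟨min (ψ x₀ - 1) (ψ x₀ - (2 / r + m * r / 2) ^ 2 / (4 * m)), ?_⟩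
  rintro _ ⟨x, hx, rfl⟩
  rcases lt_or_ge ‖x - x₀‖ r with h | h
  · exact (min_le_left _ _).trans (hnear x hx h)
  refine (min_le_right _ _).trans ?_
  set d := ‖x - x₀‖ with hd
  have hd0 : 0 < d := hr.trans_le h
  -- Moves `x` along the segment to distance r/2 from `x₀`, where `hnear` applies.
  set l := r / (2 * d) with hl
  have hl0 : 0 < l := by positivity
  have hl1 : l < 1 := by rw [hl, div_lt_one (by positivity)]; linarith
  have hmem : l • x + (1 - l) • x₀ ∈ D := hD hx hx₀ hl0.le (by linarith) (by ring)
  have hdist : ‖l • x + (1 - l) • x₀ - x₀‖ < r := by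
    have : l • x + (1 - l) • x₀ - x₀ = l • (x - x₀) := by module
    rw [this, norm_smul, Real.norm_of_nonneg hl0.le, ← hd, hl]
    have : r / (2 * d) * d = r / 2 := by field_simp
    rw [this]; linarith
  have h1 := hψ x hx x₀ hx₀ l hl0 hl1
  have h2 := hnear _ hmem hdist
  rw [← hd] at h1
  have h3 : l * (ψ x₀ - 1 / l + (1 - l) * (m * d ^ 2)) ≤ l * ψ x := by
    have : l * (1 / l) = 1 := by field_simp
    linear_combination h1 + h2 - this
  have h4 : ψ x₀ - 1 / l + (1 - l) * (m * d ^ 2) ≤ ψ x := le_of_mul_le_mul_left h3 hl0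
  have h5 : 1 / l = 2 / r * d := by rw [hl]; field_simp
  have h6 : (1 - l) * (m * d ^ 2) = m * d ^ 2 - m * r / 2 * d := by rw [hl]; field_simp
  rw [h5, h6] at h4
  refine le_trans ?_ h4
  have h7 : (2 / r + m * r / 2) ^ 2 / (4 * m) - (2 / r + m * r / 2) * d + m * d ^ 2
      = m * (d - (2 / r + m * r / 2) / (2 * m)) ^ 2 := by
    field_simp; ring
  have h8 : 0 ≤ m * (d - (2 / r + m * r / 2) / (2 * m)) ^ 2 := by positivity
  linarith

/-- Existence of a minimizer over a closed convex set of the sum of a strongly convex lower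
semicontinuous real function and a proper convex lower semicontinuous extended real function. -/
lemma exists_isMin_of_stronglyConvex [CompleteSpace X] {S : Set X} (hSc : IsClosed S)
    (hS : Convex ℝ S) {h : X → ℝ} {g : X → EReal} {m : ℝ} (hm : 0 < m)
    (hlsc : LowerSemicontinuousOn h S)
    (hstr : ∀ x ∈ S, ∀ y ∈ S, ∀ l : ℝ, 0 < l → l < 1 →
      h (l • x + (1 - l) • y) + l * (1 - l) * (m * ‖x - y‖ ^ 2) ≤ l * h x + (1 - l) * h y)
    (hgbot : ∀ x ∈ S, g x ≠ ⊥) (hgc : EConvexOn S g) (hgp : ∃ x ∈ S, g x < ⊤)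
    (hglsc : LowerSemicontinuousOn g S) :
    ∃ z ∈ S, IsMinOn (fun x => (h x : EReal) + g x) S z := by
  obtain ⟨x₀, hx₀, hx₀t⟩ := hgp
  set D := {x | x ∈ S ∧ g x < ⊤} with hD
  have hcoe : ∀ x ∈ D, ((g x).toReal : EReal) = g x := fun x hx =>
    EReal.coe_toReal hx.2.ne (hgbot x hx.1)
  have hgle : ∀ x ∈ D, ∀ y ∈ D, ∀ l : ℝ, 0 < l → l < 1 →
      g (l • x + (1 - l) • y) ≤ ((l * (g x).toReal + (1 - l) * (g y).toReal : ℝ) : EReal) := by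
    intro x hx y hy l hl hl'
    have := hgc x hx.1 y hy.1 l hl hl'
    rw [← hcoe x hx, ← hcoe y hy] at this
    exact_mod_cast this
  have hDc : Convex ℝ D := by
    rw [convex_iff_forall_pos]
    intro x hx y hy a c ha hc hac
    have hc' : c = 1 - a := by linarith
    subst hc'
    exact ⟨hS hx.1 hy.1 ha.le hc.le hac,
      (hgle x hx y hy a ha (by linarith)).trans_lt (EReal.coe_lt_top _)⟩
  set ψ : X → ℝ := fun x => h x + (g x).toReal with hψdef
  have hψ : ∀ x ∈ D, ∀ y ∈ D, ∀ l : ℝ, 0 < l → l < 1 →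
      ψ (l • x + (1 - l) • y) + l * (1 - l) * (m * ‖x - y‖ ^ 2) ≤ l * ψ x + (1 - l) * ψ y := by
    intro x hx y hy l hl hl'
    have h1 := hstr x hx.1 y hy.1 l hl hl'
    have h2 := hgle x hx y hy l hl hl'
    have h3 : l • x + (1 - l) • y ∈ D := hDc hx hy hl.le (by linarith) (by ring)
    rw [← hcoe _ h3, EReal.coe_le_coe_iff] at h2
    simp only [hψdef]
    linarith
  have hx₀D : x₀ ∈ D := ⟨hx₀, hx₀t⟩
  have hbdd : BddBelow (ψ '' D) := by
    have e1 : ∀ᶠ x in 𝓝[S] x₀, h x₀ - 1 / 2 < h x := hlsc x₀ hx₀ _ (by linarith)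
    have e2 : ∀ᶠ x in 𝓝[S] x₀, (((g x₀).toReal - 1 / 2 : ℝ) : EReal) < g x :=
      hglsc x₀ hx₀ _ (by
        change _ < g x₀
        rw [← hcoe x₀ hx₀D]
        exact_mod_cast (by linarith : (g x₀).toReal - 1 / 2 < (g x₀).toReal))
    obtain ⟨r, hr, hball⟩ := Metric.mem_nhdsWithin_iff.1 (e1.and e2)
    refine bddBelow_of_stronglyConvex hm hDc hψ hx₀D hr fun x hx hxr => ?_
    have := hball ⟨by rwa [Metric.mem_ball, dist_eq_norm], hx.1⟩
    have h2 : (((g x₀).toReal - 1 / 2 : ℝ) : EReal) < g x := this.2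
    rw [← hcoe x hx, EReal.coe_lt_coe_iff] at h2
    have h1 : h x₀ - 1 / 2 < h x := this.1
    simp only [hψdef]
    linarith
  set I := sInf (ψ '' D) with hI
  have hIle : ∀ x ∈ D, I ≤ ψ x := fun x hx => csInf_le hbdd (mem_image_of_mem _ hx)
  have happrox : ∀ n : ℕ, ∃ x ∈ D, ψ x < I + 1 / ((n : ℝ) + 1) := by
    intro n
    obtain ⟨_, ⟨x, hx, rfl⟩, hlt⟩ := exists_lt_of_csInf_lt (Nonempty.image ψ ⟨x₀, hx₀D⟩)
      (show sInf (ψ '' D) < I + 1 / ((n : ℝ) + 1) from by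
        have : (0 : ℝ) < 1 / ((n : ℝ) + 1) := by positivity
        linarith)
    exact ⟨x, hx, hlt⟩
  choose u huD hu using happrox
  have hlim0 : Tendsto (fun n : ℕ => 1 / ((n : ℝ) + 1)) atTop (𝓝 0) :=
    tendsto_one_div_add_atTop_nhds_zero_nat
  -- Strong convexity at the midpoint bounds (m/4)‖u n - u N‖² by the mean excess of the two values
  -- over the infimum.
  have hcauchy : CauchySeq u := by
    rw [Metric.cauchySeq_iff']
    intro ε hε
    obtain ⟨N, hN⟩ := (hlim0.eventually (gt_mem_nhds
      (show 0 < m * ε ^ 2 / 4 by positivity))).exists_forall_of_atTop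
    refine ⟨N, fun n hn => ?_⟩
    have h1 := hψ _ (huD n) _ (huD N) (1 / 2) (by norm_num) (by norm_num)
    have h2 := hIle _ (hDc (huD n) (huD N) (a := 1 / 2) (b := 1 - 1 / 2) (by norm_num)
      (by norm_num) (by norm_num))
    have h3 := hN n hn
    have h4 := hN N le_rfl
    have h5 := hu n
    have h6 := hu N
    have h7 : m * ‖u n - u N‖ ^ 2 < m * ε ^ 2 := by linarith
    rw [dist_eq_norm]
    exact lt_of_pow_lt_pow_left₀ 2 hε.le (lt_of_mul_lt_mul_left h7 hm.le)
  obtain ⟨z, hz⟩ := cauchySeq_tendsto_of_complete hcauchy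
  have hzS : z ∈ S := hSc.mem_of_tendsto hz (Eventually.of_forall fun n => (huD n).1)
  have hzw : Tendsto u atTop (𝓝[S] z) :=
    tendsto_nhdsWithin_iff.2 ⟨hz, Eventually.of_forall fun n => (huD n).1⟩
  -- Stated in this form because g(z) is not yet known to be finite: it gives both finiteness and
  -- minimality of `z`.
  have hgz : g z ≤ ((I - h z : ℝ) : EReal) := by
    refine le_of_forall_lt fun c hc => ?_
    obtain ⟨c', hcc', hc'⟩ := EReal.lt_iff_exists_real_btwn.1 hc
    refine hcc'.trans_le (EReal.coe_le_coe_iff.2 ?_)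
    refine le_of_forall_pos_le_add fun ε hε => ?_
    obtain ⟨n, h1, h2, h3⟩ := ((hzw.eventually (hglsc z hzS _ hc')).and
      ((hzw.eventually (hlsc z hzS (h z - ε / 2) (by linarith))).and
        (hlim0.eventually (gt_mem_nhds (half_pos hε))))).exists
    change (c' : EReal) < g (u n) at h1
    rw [← hcoe _ (huD n), EReal.coe_lt_coe_iff] at h1
    have h4 := hu n
    simp only [hψdef] at h4
    linarith
  refine ⟨z, hzS, fun x hx => ?_⟩
  have hzD : z ∈ D := ⟨hzS, hgz.trans_lt (EReal.coe_lt_top _)⟩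
  show (h z : EReal) + g z ≤ (h x : EReal) + g x
  rcases eq_or_ne (g x) ⊤ with hxt | hxt
  · rw [hxt, EReal.coe_add_top]; exact le_top
  have hxD : x ∈ D := ⟨hx, lt_top_iff_ne_top.2 hxt⟩
  rw [← hcoe z hzD, EReal.coe_le_coe_iff] at hgz
  rw [← hcoe z hzD, ← hcoe x hxD]
  have := hIle x hxD
  simp only [hψdef] at this
  exact_mod_cast (by linarith : h z + (g z).toReal ≤ h x + (g x).toReal)

end Minimization

/-! ### Weak sequential compactness in reflexive spaces. -/

section WeakCompactness

variable {X : Type*} [NormedAddCommGroup X] [NormedSpace ℝ X]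

/-- In a reflexive space a bounded sequence converges weakly along every ultrafilter. -/
lemma IsReflexive.exists_weak_limit (hX : IsReflexive X) {u : ℕ → X} {R : ℝ}
    (hu : ∀ n, ‖u n‖ ≤ R) (l : Ultrafilter ℕ) :
    ∃ z, ∀ φ : X →L[ℝ] ℝ, Tendsto (fun n => φ (u n)) l (𝓝 (φ z)) := by
  have hbd : ∀ (φ : X →L[ℝ] ℝ) (n : ℕ), ‖φ (u n)‖ ≤ R * ‖φ‖ := fun φ n =>
    (φ.le_opNorm (u n)).trans (by
      rw [mul_comm]; exact mul_le_mul_of_nonneg_right (hu n) (norm_nonneg _))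
  have hlim : ∀ φ : X →L[ℝ] ℝ, ∃ a, Tendsto (fun n => φ (u n)) l (𝓝 a) := by
    intro φ
    obtain ⟨a, -, ha⟩ := (isCompact_closedBall (0 : ℝ) (R * ‖φ‖)).ultrafilter_le_nhds
      (l.map fun n => φ (u n)) (by
        rw [le_principal_iff]
        exact Filter.mem_map.2 (Filter.univ_mem' fun n => by simpa using hbd φ n))
    exact ⟨a, ha⟩
  choose a ha using hlim
  -- The limits along the ultrafilter form a bounded functional on the dual, which reflexivity
  -- represents by a point.
  let A : (X →L[ℝ] ℝ) →ₗ[ℝ] ℝ :=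
    { toFun := a
      map_add' := fun φ χ => tendsto_nhds_unique (ha (φ + χ)) ((ha φ).add (ha χ))
      map_smul' := fun c φ => tendsto_nhds_unique (ha (c • φ)) ((ha φ).const_mul c) }
  obtain ⟨z, hz⟩ := hX (A.mkContinuous R fun φ =>
    le_of_tendsto (ha φ).norm (Eventually.of_forall fun n => hbd φ n))
  refine ⟨z, fun φ => ?_⟩
  have : φ z = a φ := by
    rw [← NormedSpace.dual_def ℝ X z φ, hz]; rfl
  rw [this]
  exact ha φ

/-- Closed convex sets are weakly closed. -/
lemma mem_of_weak_limit {ι : Type*} {l : Filter ι} [l.NeBot] {C : Set X} (hC : IsClosed C)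
    (hconv : Convex ℝ C) {u : ι → X} {z : X} (hu : ∀ᶠ i in l, u i ∈ C)
    (hz : ∀ φ : X →L[ℝ] ℝ, Tendsto (fun i => φ (u i)) l (𝓝 (φ z))) : z ∈ C := by
  by_contra hzC
  obtain ⟨φ, c, h1, h2⟩ := geometric_hahn_banach_point_closed hconv hC hzC
  obtain ⟨i, hi, hi'⟩ := (hu.and ((hz φ).eventually (gt_mem_nhds h1))).exists
  exact lt_asymm (h2 _ hi) hi'

/-- The points of a separable set are separated from `0` by a sequence of functionals. -/
lemma exists_seq_separating {Y : Set X} (hY : TopologicalSpace.IsSeparable Y) :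
    ∃ φ : ℕ → X →L[ℝ] ℝ, ∀ z ∈ Y, (∀ m, φ m z = 0) → z = 0 := by
  obtain ⟨c, hc, hYc⟩ := hY
  rcases c.eq_empty_or_nonempty with rfl | hne
  · exact ⟨fun _ => 0, fun z hz => by simpa using hYc hz⟩
  obtain ⟨y, rfl⟩ := hc.exists_eq_range hne
  -- Norming functionals of a dense sequence: if all of them vanish at `z`, then ‖y m‖ ≤ ‖y m - z‖,
  -- so `z` is small whenever `y m` is close to it.
  choose φ hφ1 hφ2 using fun m => exists_dual_vector'' ℝ (y m)
  refine ⟨φ, fun z hz h0 => ?_⟩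
  refine norm_le_zero_iff.1 (le_of_forall_pos_le_add fun ε hε => ?_)
  obtain ⟨_, ⟨m, rfl⟩, hm⟩ := Metric.mem_closure_iff.1 (hYc hz) (ε / 2) (half_pos hε)
  rw [dist_eq_norm] at hm
  have h1 : ‖y m‖ ≤ ‖y m - z‖ := by
    have h2 : φ m (y m - z) = ‖y m‖ := by
      rw [map_sub, h0 m, sub_zero]; exact hφ2 m
    rw [← h2]
    refine (le_abs_self _).trans (((φ m).le_opNorm _).trans ?_)
    exact mul_le_of_le_one_left (norm_nonneg _) (hφ1 m)
  have h3 : ‖z‖ ≤ ‖z - y m‖ + ‖y m‖ := by simpa using norm_add_le (z - y m) (y m)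
  rw [norm_sub_rev] at h1
  linarith

/-- In a reflexive space bounded sequences have weakly convergent subsequences. -/
theorem IsReflexive.exists_subseq_weaklyTendsto (hX : IsReflexive X) {u : ℕ → X} {R : ℝ}
    (hu : ∀ n, ‖u n‖ ≤ R) :
    ∃ (z : X) (n : ℕ → ℕ), StrictMono n ∧ WeaklyTendsto (u ∘ n) z := by
  -- On the closed span of the sequence countably many functionals separate points, so compactness
  -- of a countable product supplies the subsequence.
  set Y : Submodule ℝ X := (Submodule.span ℝ (range u)).topologicalClosure with hYdef
  have hYsep : TopologicalSpace.IsSeparable (Y : Set X) := by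
    rw [hYdef, Submodule.topologicalClosure_coe]
    exact ((countable_range u).isSeparable.span (R := ℝ)).closure
  have huY : ∀ n, u n ∈ Y := fun n =>
    Submodule.le_topologicalClosure _ (Submodule.subset_span (mem_range_self n))
  obtain ⟨φ, hφ⟩ := exists_seq_separating hYsep
  have hcpt : IsCompact (univ.pi fun m => Metric.closedBall (0 : ℝ) (‖φ m‖ * R)) :=
    isCompact_univ_pi fun m => isCompact_closedBall _ _
  obtain ⟨a, -, n, hn, hlim⟩ := hcpt.tendsto_subseq (x := fun k m => φ m (u k)) (fun k m _ => by
    simpa using ((φ m).le_opNorm (u k)).trans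
      (mul_le_mul_of_nonneg_left (hu k) (norm_nonneg _)))
  rw [tendsto_pi_nhds] at hlim
  choose w hw using fun l : Ultrafilter ℕ => hX.exists_weak_limit (fun k => hu (n k)) l
  have hwY : ∀ l, w l ∈ Y := fun l =>
    mem_of_weak_limit (l := (l : Filter ℕ)) (Submodule.isClosed_topologicalClosure _) Y.convex
      (Eventually.of_forall fun k => huY (n k)) (hw l)
  have hwa : ∀ l : Ultrafilter ℕ, (l : Filter ℕ) ≤ atTop → ∀ m, φ m (w l) = a m :=
    fun l hl m => tendsto_nhds_unique (hw l (φ m)) ((hlim m).mono_left hl)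
  -- The weak limits along all ultrafilters finer than `atTop` lie in `Y` and agree under every `φ
  -- m`. Hence they coincide, which is convergence along `atTop`.
  obtain ⟨l₀, hl₀⟩ := Ultrafilter.exists_le (atTop : Filter ℕ)
  refine ⟨w l₀, n, hn, fun χ => ?_⟩
  rw [tendsto_iff_ultrafilter]
  intro l hl
  have : w l = w l₀ := by
    refine sub_eq_zero.1 (hφ _ (Y.sub_mem (hwY l) (hwY l₀)) fun m => ?_)
    rw [map_sub, hwa l hl m, hwa l₀ hl₀ m, sub_self]
  rw [← this]
  exact hw l χ

end WeakCompactness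

/-! ### The composite problem with a real-valued kernel and the proximal inequality. -/

section CompositeModels

variable {X : Type*} [NormedAddCommGroup X] [NormedSpace ℝ X]

/-- The Bregman divergence of a real-valued function `β` with gradient `b'`. -/
noncomputable def realBregman (β : X → ℝ) (b' : X → X →L[ℝ] ℝ) (x y : X) : ℝ :=
  β x - β y - b' y (x - y)

/-- Converts the gradient difference in the optimality condition of a proximal point into a
difference of divergences. -/
lemma realBregman_three_point (β : X → ℝ) (b' : X → X →L[ℝ] ℝ) (x y z : X) :
    realBregman β b' x y = realBregman β b' z y + realBregman β b' x z + (b' z - b' y) (x - z) := by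
  have : b' y (x - y) = b' y (x - z) + b' y (z - y) := by
    rw [← map_add, sub_add_sub_cancel]
  simp only [realBregman, sub_apply, this]
  ring

/-- The real part of the proximal model: linearized `f` plus a multiple of the divergence. -/
noncomputable def quadModel (β : X → ℝ) (b' : X → X →L[ℝ] ℝ) (f : X → ℝ) (f' : X → X →L[ℝ] ℝ)
    (κ : ℝ) (y x : X) : ℝ :=
  f y + f' y (x - y) + κ * realBregman β b' x y

/-- Data of a composite minimization problem on `C` with a strongly convex real kernel `β`, which
is differentiable on `U`. -/
structure IsCompositeModel (U C : Set X) (β : X → ℝ) (b' : X → X →L[ℝ] ℝ) (f : X → ℝ)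
    (f' : X → X →L[ℝ] ℝ) (g : X → EReal) (μ : ℝ) : Prop where
  zone_convex : Convex ℝ U
  closed : IsClosed C
  convex : Convex ℝ C
  pos : 0 < μ
  kernel_strong : ∀ x ∈ C, ∀ y ∈ C, ∀ l : ℝ, 0 < l → l < 1 →
    β (l • x + (1 - l) • y) + l * (1 - l) * (μ / 2 * ‖x - y‖ ^ 2) ≤ l * β x + (1 - l) * β y
  kernel_lsc : LowerSemicontinuousOn β C
  kernel_grad : ∀ x ∈ U, HasGateauxDerivAt β (b' x) x
  smooth_convex : ConvexOn ℝ C f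
  smooth_lsc : LowerSemicontinuousOn f C
  smooth_grad : ∀ x ∈ U, HasGateauxDerivAt f (f' x) x
  ne_bot : ∀ x ∈ C, g x ≠ ⊥
  econvex : EConvexOn C g
  lsc : LowerSemicontinuousOn g C

namespace IsCompositeModel

variable {U C : Set X} {β : X → ℝ} {b' : X → X →L[ℝ] ℝ} {f : X → ℝ} {f' : X → X →L[ℝ] ℝ}
  {g : X → EReal} {μ : ℝ}

lemma coe_toReal (M : IsCompositeModel U C β b' f f' g μ) {x : X} (hx : x ∈ C) (hg : g x < ⊤) :
    ((g x).toReal : EReal) = g x :=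
  EReal.coe_toReal hg.ne (M.ne_bot x hx)

lemma combo_le (M : IsCompositeModel U C β b' f f' g μ) {x y : X} (hx : x ∈ C) (hgx : g x < ⊤)
    (hy : y ∈ C) (hgy : g y < ⊤) {l : ℝ} (hl : 0 < l) (hl' : l < 1) :
    g (l • x + (1 - l) • y) ≤ ((l * (g x).toReal + (1 - l) * (g y).toReal : ℝ) : EReal) := by
  have := M.econvex x hx y hy l hl hl'
  rw [← M.coe_toReal hx hgx, ← M.coe_toReal hy hgy] at this
  exact_mod_cast this

/-- The gradient inequality for `β` with the strong convexity remainder kept. -/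
lemma sq_norm_le (M : IsCompositeModel U C β b' f f' g μ) {x y : X} (hx : x ∈ C)
    (hy : y ∈ C ∩ U) : μ / 2 * ‖x - y‖ ^ 2 ≤ realBregman β b' x y := by
  have := add_lineDeriv_le (M.kernel_grad y hy.2 (x - y)) (M.kernel_strong x hx y hy.1)
  rw [realBregman]
  linarith

lemma bregman_nonneg (M : IsCompositeModel U C β b' f f' g μ) {x y : X} (hx : x ∈ C)
    (hy : y ∈ C ∩ U) : 0 ≤ realBregman β b' x y :=
  le_trans (mul_nonneg (half_pos M.pos).le (sq_nonneg _)) (M.sq_norm_le hx hy)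

lemma gradient_le (M : IsCompositeModel U C β b' f f' g μ) {x y : X} (hx : x ∈ C)
    (hy : y ∈ C ∩ U) : f y + f' y (x - y) ≤ f x := by
  have := add_lineDeriv_le (c := 0) (M.smooth_grad y hy.2 (x - y)) (fun l hl hl' => by
    simpa using M.smooth_convex.2 hx hy.1 hl.le (sub_nonneg.2 hl'.le) (by ring))
  linarith

/-- Existence of proximal points. -/
lemma exists_prox [CompleteSpace X] (M : IsCompositeModel U C β b' f f' g μ) {S : Set X}
    (hSC : S ⊆ C) (hSc : IsClosed S) (hS : Convex ℝ S) (hg : ∃ x ∈ S, g x < ⊤) {κ : ℝ}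
    (hκ : 0 < κ) (y : X) :
    ∃ z ∈ S, IsMinOn (fun x => (quadModel β b' f f' κ y x : EReal) + g x) S z := by
  have hM := M.pos
  refine exists_isMin_of_stronglyConvex hSc hS (m := κ * (μ / 2)) (by positivity) ?_ ?_
    (fun x hx => M.ne_bot x (hSC hx)) (fun x hx y hy => M.econvex x (hSC hx) y (hSC hy)) hg
    (M.lsc.mono hSC)
  · have h1 : LowerSemicontinuousOn (fun x => κ * β x) S := by
      intro x hx c hc
      have h2 : c / κ < β x := by
        rw [div_lt_iff₀ hκ, mul_comm]; exact hc
      filter_upwards [M.kernel_lsc.mono hSC x hx _ h2] with w hw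
      have h3 : c / κ < β w := hw
      rw [div_lt_iff₀ hκ, mul_comm] at h3
      exact h3
    have h2 : LowerSemicontinuousOn
        (fun x => f y + f' y (x - y) + κ * (- β y - b' y (x - y))) S :=
      (by fun_prop : Continuous fun x => f y + f' y (x - y) + κ * (- β y - b' y (x - y)))
        |>.lowerSemicontinuous.lowerSemicontinuousOn S
    have h3 : quadModel β b' f f' κ y
        = fun x => κ * β x + (f y + f' y (x - y) + κ * (- β y - b' y (x - y))) := by
      ext x
      simp only [quadModel, realBregman]
      ring
    rw [h3]
    exact h1.add h2
  · intro x hx w hw l hl hl'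
    have h1 := mul_le_mul_of_nonneg_left (M.kernel_strong x (hSC hx) w (hSC hw) l hl hl') hκ.le
    have h2 : l • x + (1 - l) • w - y = l • (x - y) + (1 - l) • (w - y) := by module
    simp only [quadModel, realBregman, h2, map_add, map_smul, smul_eq_mul]
    linear_combination h1

/-- The value of the objective is below the model if the gradient of `f` is Lipschitz
continuous with a small constant. -/
lemma le_quadModel (M : IsCompositeModel U C β b' f f' g μ) {S : Set X} (hSC : S ⊆ C)
    (hS : Convex ℝ S) {L : ℝ}
    (hL : ∀ x ∈ S ∩ U, ∀ y ∈ S ∩ U, ‖f' x - f' y‖ ≤ L * ‖x - y‖) {y z : X} (hL0 : 0 ≤ L)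
    (hy : y ∈ S ∩ U) (hz : z ∈ S ∩ U) : f z ≤ quadModel β b' f f' (L / μ) y z := by
  have h1 := le_of_lipschitz_gradient (hS.inter M.zone_convex)
    (fun x hx => M.smooth_grad x hx.2) hL hy hz
  have h2 := mul_le_mul_of_nonneg_left (M.sq_norm_le (hSC hz.1) ⟨hSC hy.1, hy.2⟩)
    (div_nonneg hL0 M.pos.le)
  have h3 : L / μ * (μ / 2 * ‖z - y‖ ^ 2) = L / 2 * ‖z - y‖ ^ 2 := by
    have := M.pos.ne'
    field_simp
  rw [quadModel]
  linarith

/-- The basic inequality satisfied by a proximal step. -/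
lemma prox_inequality (M : IsCompositeModel U C β b' f f' g μ) {S : Set X} (hSC : S ⊆ C)
    (hS : Convex ℝ S) {κ : ℝ} {y z : X} (hy : y ∈ C ∩ U) (hz : z ∈ S ∩ U)
    (hmin : IsMinOn (fun x => (quadModel β b' f f' κ y x : EReal) + g x) S z)
    (hfz : (f z : EReal) + g z ≤ (quadModel β b' f f' κ y z : EReal) + g z)
    {x : X} (hx : x ∈ S) (hgx : g x < ⊤) :
    g z < ⊤ ∧ f z + (g z).toReal + κ * (realBregman β b' x z - realBregman β b' x y)
      ≤ f x + (g x).toReal := by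
  have hcx := M.coe_toReal (hSC hx) hgx
  have hgz : g z < ⊤ := by
    have h1 : (quadModel β b' f f' κ y z : EReal) + g z ≤ (quadModel β b' f f' κ y x : EReal) + g x :=
      hmin hx
    by_contra h
    rw [not_lt_top_iff.1 h, EReal.coe_add_top, ← hcx] at h1
    exact absurd h1 (not_le.2 (by exact_mod_cast EReal.coe_lt_top _))
  have hcz := M.coe_toReal (hSC hz.1) hgz
  refine ⟨hgz, ?_⟩
  rw [← hcz] at hfz
  have hfz' : f z ≤ quadModel β b' f f' κ y z := by
    have : f z + (g z).toReal ≤ quadModel β b' f f' κ y z + (g z).toReal := by exact_mod_cast hfz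
    linarith
  -- First-order optimality of `z`: it is compared with z + l(x - z), where `g` is bounded by
  -- convexity. Apart from κβ the smooth part is affine, so only the derivative of `β` at `z`
  -- enters.
  have hopt : (g z).toReal - (g x).toReal - f' y (x - z) + κ * b' y (x - z) ≤ κ * b' z (x - z) := by
    have hd : HasLineDerivAt ℝ (fun w => κ * β w) (κ * b' z (x - z)) z (x - z) :=
      HasDerivAt.const_mul κ (M.kernel_grad z hz.2 (x - z))
    refine le_of_hasLineDerivAt (e := 0) hd fun l hl hl' => ?_
    have hw : z + l • (x - z) = l • x + (1 - l) • z := by module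
    have hwS : z + l • (x - z) ∈ S := hS.add_smul_sub_mem hz.1 hx ⟨hl.le, hl'.le⟩
    have h1 : (quadModel β b' f f' κ y z : EReal) + g z
        ≤ (quadModel β b' f f' κ y (z + l • (x - z)) : EReal) + g (z + l • (x - z)) := hmin hwS
    have h2 := M.combo_le (hSC hx) hgx (hSC hz.1) hgz hl hl'
    rw [← hw] at h2
    have h3 : (quadModel β b' f f' κ y z : EReal) + ((g z).toReal : EReal)
        ≤ (quadModel β b' f f' κ y (z + l • (x - z)) : EReal)
          + ((l * (g x).toReal + (1 - l) * (g z).toReal : ℝ) : EReal) := by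
      rw [hcz]; exact h1.trans (add_le_add le_rfl h2)
    have h4 : quadModel β b' f f' κ y z + (g z).toReal
        ≤ quadModel β b' f f' κ y (z + l • (x - z))
          + (l * (g x).toReal + (1 - l) * (g z).toReal) := by exact_mod_cast h3
    have h5 : z + l • (x - z) - y = (z - y) + l • (x - z) := by module
    simp only [quadModel, realBregman, h5, map_add, map_smul, smul_eq_mul] at h4
    linear_combination h4
  have h3 := realBregman_three_point β b' x y z
  have h4 := M.gradient_le (hSC hx) hy
  have h5 : f' y (x - y) = f' y (x - z) + f' y (z - y) := by
    rw [← map_add, sub_add_sub_cancel]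
  rw [sub_apply] at h3
  rw [quadModel] at hfz'
  rw [h3]
  linear_combination hfz' + hopt + h4 - h5

end IsCompositeModel

end CompositeModels

/-! ### Telescoping estimates for descent runs. -/

section Convergence

/-- Sublevel sets of sums of lower semicontinuous functions on a closed set are closed. -/
lemma isClosed_sublevel_add {X : Type*} [NormedAddCommGroup X] {S : Set X} (hS : IsClosed S) {h : X → ℝ} {g : X → EReal}
    (hh : LowerSemicontinuousOn h S) (hg : LowerSemicontinuousOn g S) (t : ℝ) :
    IsClosed {x | x ∈ S ∧ (h x : EReal) + g x ≤ t} := by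
  refine IsSeqClosed.isClosed fun u z hu hz => ?_
  have hzS : z ∈ S := hS.mem_of_tendsto hz (Eventually.of_forall fun n => (hu n).1)
  have hzw : Tendsto u atTop (𝓝[S] z) :=
    tendsto_nhdsWithin_iff.2 ⟨hz, Eventually.of_forall fun n => (hu n).1⟩
  refine ⟨hzS, ?_⟩
  by_contra hlt
  have h1 : ((t - h z : ℝ) : EReal) < g z := by
    by_contra h2
    refine hlt ((add_le_add le_rfl (not_lt.1 h2)).trans ?_)
    exact_mod_cast (by linarith : h z + (t - h z) ≤ t)
  -- A real c between t - h(z) and g(z) splits the strict inequality, so the two semicontinuities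
  -- can be used separately.
  obtain ⟨c, hc1, hc2⟩ := EReal.lt_iff_exists_real_btwn.1 h1
  rw [EReal.coe_lt_coe_iff] at hc1
  obtain ⟨n, h2, h3⟩ := ((hzw.eventually (hg z hzS _ hc2)).and
    (hzw.eventually (hh z hzS (t - c) (by linarith)))).exists
  have h4 : ((c : ℝ) : EReal) < g (u n) := h2
  have h5 : t - c < h (u n) := h3
  have h6 : ((h (u n) + c : ℝ) : EReal) ≤ t := by
    rw [EReal.coe_add]
    exact (add_le_add le_rfl h4.le).trans (hu n).2
  rw [EReal.coe_le_coe_iff] at h6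
  linarith

/-- Telescoping of `w (k + 1) ≤ d k - d (k + 1)` for nonincreasing `w`. -/
lemma mul_add_le_of_antitone {w d : ℕ → ℝ} {k₀ : ℕ} (hw : ∀ k, k₀ < k → w (k + 1) ≤ w k)
    (hd : ∀ k, k₀ ≤ k → w (k + 1) ≤ d k - d (k + 1)) (k : ℕ) (hk : k₀ ≤ k) :
    ((k : ℝ) + 1 - k₀) * w (k + 1) + d (k + 1) ≤ d k₀ := by
  induction k, hk using Nat.le_induction with
  | base => have := hd k₀ le_rfl; linarith
  | succ k hk ih =>
    have h1 := hd (k + 1) (by omega)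
    have h2 := hw (k + 1) (by omega)
    have h3 : (0 : ℝ) ≤ (k : ℝ) + 1 - k₀ := by
      have : (k₀ : ℝ) ≤ k := by exact_mod_cast hk
      linarith
    have h4 := mul_le_mul_of_nonneg_left h2 h3
    push_cast
    linarith

variable {X : Type*} [NormedAddCommGroup X] [NormedSpace ℝ X]

/-- Iterates which satisfy the basic proximal inequality with respect to an increasing sequence of
sets, with nondecreasing step parameters. -/
structure IsDescentRun (U : Set X) (β : X → ℝ) (b' : X → X →L[ℝ] ℝ) (f : X → ℝ)
    (g : X → EReal) (μ : ℝ) (S : ℕ → Set X) (L : ℕ → ℝ) (x : ℕ → X) : Prop where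
  set_mono : ∀ k, 1 ≤ k → S k ⊆ S (k + 1)
  mem : ∀ k, 1 ≤ k → x k ∈ S k ∩ U
  finite : ∀ k, 1 ≤ k → g (x (k + 1)) < ⊤
  pos : ∀ k, 1 ≤ k → 0 < L k
  mono : ∀ k, 1 ≤ k → L k ≤ L (k + 1)
  inequality : ∀ k, 1 ≤ k → ∀ w ∈ S (k + 1), g w < ⊤ →
    f (x (k + 1)) + (g (x (k + 1))).toReal
      + L (k + 1) / μ * (realBregman β b' w (x (k + 1)) - realBregman β b' w (x k))
      ≤ f w + (g w).toReal

lemma mono_of_succ {X : Type*} {S : ℕ → Set X} (h : ∀ k, 1 ≤ k → S k ⊆ S (k + 1)) {i j : ℕ} (hi : 1 ≤ i)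
    (hij : i ≤ j) : S i ⊆ S j := by
  induction j, hij using Nat.le_induction with
  | base => exact subset_rfl
  | succ j hj ih => exact ih.trans (h j (hi.trans hj))

namespace IsDescentRun

variable {U C : Set X} {β : X → ℝ} {b' : X → X →L[ℝ] ℝ} {f : X → ℝ} {f' : X → X →L[ℝ] ℝ}
  {g : X → EReal} {μ : ℝ} {S : ℕ → Set X} {L : ℕ → ℝ} {x : ℕ → X}

/-- The choice w = x_k in the basic inequality. It requires g(x_k) < ∞, which is guaranteed only
from index 2 on. -/
lemma value_le (R : IsDescentRun U β b' f g μ S L x) (M : IsCompositeModel U C β b' f f' g μ)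
    (hSC : ∀ k, 1 ≤ k → S k ⊆ C) {k : ℕ} (hk : 2 ≤ k) :
    f (x (k + 1)) + (g (x (k + 1))).toReal ≤ f (x k) + (g (x k)).toReal := by
  obtain ⟨j, rfl⟩ : ∃ j, k = j + 1 := ⟨k - 1, by omega⟩
  have h1 := R.mem (j + 1) (by omega)
  have h2 := R.mem (j + 1 + 1) (by omega)
  have h3 := R.inequality (j + 1) (by omega) (x (j + 1)) (R.set_mono _ (by omega) h1.1)
    (R.finite j (by omega))
  have h4 : realBregman β b' (x (j + 1)) (x (j + 1)) = 0 := by simp [realBregman]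
  have h5 := M.bregman_nonneg (hSC _ (by omega) h1.1) (y := x (j + 1 + 1))
    ⟨hSC _ (by omega) h2.1, h2.2⟩
  have h6 : 0 ≤ L (j + 1 + 1) / μ * realBregman β b' (x (j + 1)) (x (j + 1 + 1)) :=
    mul_nonneg (div_nonneg (R.pos _ (by omega)).le M.pos.le) h5
  rw [h4, sub_zero] at h3
  linarith

/-- Dividing by L_{k+1}/μ removes the varying factor from the divergences, so that the right side
telescopes. -/
lemma bregman_le (R : IsDescentRun U β b' f g μ S L x) (hμ : 0 < μ) {w : X} (hg : g w < ⊤)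
    {k₀ : ℕ} (hk₀ : 1 ≤ k₀) (hwk : w ∈ S k₀) {k : ℕ} (hk : k₀ ≤ k) :
    (f (x (k + 1)) + (g (x (k + 1))).toReal - (f w + (g w).toReal)) * (μ / L (k + 1))
      ≤ realBregman β b' w (x k) - realBregman β b' w (x (k + 1)) := by
  have h1 := R.inequality k (by omega) w (mono_of_succ R.set_mono hk₀ (by omega) hwk) hg
  have h2 := R.pos (k + 1) (by omega)
  rw [mul_div_assoc', div_le_iff₀ h2]
  have h3 : L (k + 1) / μ * (realBregman β b' w (x (k + 1)) - realBregman β b' w (x k)) * μ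
      = L (k + 1) * (realBregman β b' w (x (k + 1)) - realBregman β b' w (x k)) := by
    field_simp
  have h4 := mul_le_mul_of_nonneg_right h1 hμ.le
  rw [add_mul, h3] at h4
  linarith

/-- Fejér monotonicity: the divergence from a point with no larger value cannot increase once that
point belongs to the current set. -/
lemma bregman_antitone (R : IsDescentRun U β b' f g μ S L x) (hμ : 0 < μ) {w : X} (hg : g w < ⊤)
    (hw : ∀ k, 1 ≤ k → f w + (g w).toReal ≤ f (x (k + 1)) + (g (x (k + 1))).toReal) {k₀ : ℕ}
    (hk₀ : 1 ≤ k₀) (hwk : w ∈ S k₀) {k : ℕ} (hk : k₀ ≤ k) :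
    realBregman β b' w (x (k + 1)) ≤ realBregman β b' w (x k) := by
  have h1 := R.bregman_le hμ hg hk₀ hwk hk
  have h2 := hw k (by omega)
  have h3 : 0 ≤ (f (x (k + 1)) + (g (x (k + 1))).toReal - (f w + (g w).toReal)) *
      (μ / L (k + 1)) :=
    mul_nonneg (by linarith) (div_nonneg hμ.le (R.pos _ (by omega)).le)
  linarith

/-- The excess values and the factors μ/L_k are both nonnegative and nonincreasing, so the last
product bounds all earlier ones in the telescoping sum. -/
lemma rate (R : IsDescentRun U β b' f g μ S L x) (M : IsCompositeModel U C β b' f f' g μ)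
    (hSC : ∀ k, 1 ≤ k → S k ⊆ C) {w : X} (hwC : w ∈ C) (hg : g w < ⊤)
    (hw : ∀ k, 1 ≤ k → f w + (g w).toReal ≤ f (x (k + 1)) + (g (x (k + 1))).toReal) {k₀ : ℕ}
    (hk₀ : 1 ≤ k₀) (hwk : w ∈ S k₀) {k : ℕ} (hk : k₀ ≤ k) :
    ((k : ℝ) + 1 - k₀) * (f (x (k + 1)) + (g (x (k + 1))).toReal - (f w + (g w).toReal)) * μ
      ≤ L (k + 1) * realBregman β b' w (x k₀) := by
  have hμ := M.pos
  have h1 := mul_add_le_of_antitone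
    (w := fun k => (f (x k) + (g (x k)).toReal - (f w + (g w).toReal)) * (μ / L k))
    (d := fun k => realBregman β b' w (x k)) (k₀ := k₀)
    (fun k hk => by
      -- Here 1 ≤ k₀ < k, so that k ≥ 2 and the possibly infinite value at `x 1` plays no part.
      have h1 := R.value_le M hSC (k := k) (by omega)
      have h2 := hw k (by omega)
      have h3 := R.pos k (by omega)
      have h4 := R.mono k (by omega)
      refine mul_le_mul (by linarith) ?_ (div_nonneg hμ.le (h3.le.trans h4)) (by linarith)
      exact div_le_div_of_nonneg_left hμ.le h3 h4)
    (fun k hk => R.bregman_le hμ hg hk₀ hwk hk) k hk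
  have h2 := R.mem (k + 1) (by omega)
  have h3 := M.bregman_nonneg hwC (y := x (k + 1)) ⟨hSC _ (by omega) h2.1, h2.2⟩
  have h4 := R.pos (k + 1) (by omega)
  have h5 : ((k : ℝ) + 1 - k₀) *
      ((f (x (k + 1)) + (g (x (k + 1))).toReal - (f w + (g w).toReal)) * (μ / L (k + 1)))
      ≤ realBregman β b' w (x k₀) := by
    linarith
  rw [mul_div_assoc', mul_div_assoc', div_le_iff₀ h4] at h5
  linarith

end IsDescentRun

end Convergence

/-! ### Minimizers, the explicit rate and weak convergence. -/

section Minimizers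

variable {X : Type*} [NormedAddCommGroup X] [NormedSpace ℝ X]
  {U C : Set X} {β : X → ℝ} {b' : X → X →L[ℝ] ℝ} {f : X → ℝ} {f' : X → X →L[ℝ] ℝ}
  {g : X → EReal} {μ : ℝ} {S : ℕ → Set X} {L : ℕ → ℝ} {x : ℕ → X}

lemma IsCompositeModel.objective_eq (M : IsCompositeModel U C β b' f f' g μ) {y : X} (hy : y ∈ C)
    (hg : g y < ⊤) : objective C f g y = ((f y + (g y).toReal : ℝ) : EReal) := by
  rw [objective, if_pos hy, EReal.coe_add, M.coe_toReal hy hg]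

/-- Reduces extended-real minimality to real inequalities; properness of `g` makes the value at a
minimizer finite. -/
lemma IsCompositeModel.mem_minimizers_iff (M : IsCompositeModel U C β b' f f' g μ)
    (hgp : ∃ y ∈ C, g y < ⊤) {w : X} :
    w ∈ minimizers C f g ↔ w ∈ C ∧ g w < ⊤ ∧
      ∀ y ∈ C, g y < ⊤ → f w + (g w).toReal ≤ f y + (g y).toReal := by
  refine ⟨fun h => ?_, fun ⟨h1, h2, h3⟩ => ⟨h1, fun y hy => ?_⟩⟩
  · have hle : ∀ y ∈ C, objective C f g w ≤ objective C f g y := fun y hy => h.2 hy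
    obtain ⟨y₀, hy₀, hgy₀⟩ := hgp
    have hgw : g w < ⊤ := by
      by_contra hlt
      have h1 := hle y₀ hy₀
      rw [M.objective_eq hy₀ hgy₀, objective, if_pos h.1, not_lt_top_iff.1 hlt,
        EReal.coe_add_top] at h1
      exact absurd h1 (not_le.2 (EReal.coe_lt_top _))
    refine ⟨h.1, hgw, fun y hy hgy => ?_⟩
    have h1 := hle y hy
    rw [M.objective_eq hy hgy, M.objective_eq h.1 hgw] at h1
    exact_mod_cast h1
  · show objective C f g w ≤ objective C f g y
    rcases eq_or_ne (g y) ⊤ with hy' | hy'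
    · rw [objective, objective, if_pos hy, hy', EReal.coe_add_top]
      exact le_top
    · rw [M.objective_eq hy hy'.lt_top, M.objective_eq h1 h2]
      exact_mod_cast h3 y hy hy'.lt_top

/-- Weak limits of sequences whose values tend to the minimal value are minimizers. -/
lemma IsCompositeModel.mem_minimizers_of_weaklyTendsto (M : IsCompositeModel U C β b' f f' g μ)
    {w : X} (hw : w ∈ minimizers C f g) (hgp : ∃ y ∈ C, g y < ⊤) {u : ℕ → X}
    (hu : ∀ n, u n ∈ C ∧ g (u n) < ⊤)
    (hlim : Tendsto (fun n => f (u n) + (g (u n)).toReal) atTop (𝓝 (f w + (g w).toReal)))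
    {z : X} (hz : WeaklyTendsto u z) : z ∈ minimizers C f g := by
  have hw' := (M.mem_minimizers_iff hgp).1 hw
  -- Sublevel sets are closed and convex, hence weakly closed, and each one above the minimal level
  -- eventually contains the sequence.
  have key : ∀ t : ℝ, f w + (g w).toReal < t → z ∈ {y | y ∈ C ∧ (f y : EReal) + g y ≤ t} := by
    intro t ht
    refine mem_of_weak_limit (l := atTop) (isClosed_sublevel_add M.closed M.smooth_lsc M.lsc t)
      ?_ ?_ hz
    · have hlt : ∀ y : X, (f y : EReal) + g y ≤ t → g y < ⊤ := by
        intro y hy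
        by_contra h
        rw [not_lt_top_iff.1 h, EReal.coe_add_top] at hy
        exact absurd hy (not_le.2 (EReal.coe_lt_top _))
      rw [convex_iff_forall_pos]
      rintro y ⟨hyC, hyt⟩ v ⟨hvC, hvt⟩ a c ha hc hac
      have hc' : c = 1 - a := by linarith
      subst hc'
      refine ⟨M.convex hyC hvC ha.le hc.le hac, ?_⟩
      have h1 := M.smooth_convex.2 hyC hvC ha.le hc.le hac
      have h2 := M.combo_le hyC (hlt y hyt) hvC (hlt v hvt) ha (by linarith)
      rw [← M.coe_toReal hyC (hlt y hyt)] at hyt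
      rw [← M.coe_toReal hvC (hlt v hvt)] at hvt
      have h3 : f y + (g y).toReal ≤ t := by exact_mod_cast hyt
      have h4 : f v + (g v).toReal ≤ t := by exact_mod_cast hvt
      refine (add_le_add le_rfl h2).trans ?_
      rw [← EReal.coe_add, EReal.coe_le_coe_iff]
      simp only [smul_eq_mul] at h1
      have h5 := mul_le_mul_of_nonneg_left h3 ha.le
      have h6 := mul_le_mul_of_nonneg_left h4 hc.le
      linarith
    · filter_upwards [hlim.eventually (gt_mem_nhds ht)] with n hn
      refine ⟨(hu n).1, ?_⟩
      rw [← M.coe_toReal (hu n).1 (hu n).2]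
      exact_mod_cast hn.le
  have hzC : z ∈ C := (key _ (lt_add_one _)).1
  have hzg : g z < ⊤ := by
    by_contra h
    have := (key _ (lt_add_one _)).2
    rw [not_lt_top_iff.1 h, EReal.coe_add_top] at this
    exact absurd this (not_le.2 (EReal.coe_lt_top _))
  refine (M.mem_minimizers_iff hgp).2 ⟨hzC, hzg, fun y hy hgy => ?_⟩
  refine le_trans (le_of_forall_gt_imp_ge_of_dense fun t ht => ?_) (hw'.2.2 y hy hgy)
  have := (key t ht).2
  rw [← M.coe_toReal hzC hzg] at this
  exact_mod_cast this

namespace IsDescentRun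

variable (R : IsDescentRun U β b' f g μ S L x) (M : IsCompositeModel U C β b' f f' g μ)
  (hSC : ∀ k, 1 ≤ k → S k ⊆ C) (hgp : ∃ y ∈ C, g y < ⊤)

include R hSC in
lemma mem_inter {k : ℕ} (hk : 1 ≤ k) : x k ∈ C ∩ U := ⟨hSC k hk (R.mem k hk).1, (R.mem k hk).2⟩

include R M hSC hgp in
lemma min_le {w : X} (hw : w ∈ minimizers C f g) (k : ℕ) (hk : 1 ≤ k) :
    f w + (g w).toReal ≤ f (x (k + 1)) + (g (x (k + 1))).toReal :=
  ((M.mem_minimizers_iff hgp).1 hw).2.2 _ (R.mem_inter hSC (by omega)).1 (R.finite k hk)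

include R M hSC hgp in
/-- The explicit rate of convergence when the step parameters grow at most like `α * k ^ q`. -/
lemma rate_of_growth {α q : ℝ} {K : ℕ}
    (hK : ∀ k, K ≤ k → L k ≤ α * (k : ℝ) ^ q) {w : X} (hw : w ∈ minimizers C f g) {k₀ : ℕ}
    (hk₀ : 1 ≤ k₀) (hKk : K ≤ k₀) (hwk : w ∈ S k₀) {k : ℕ} (hk : k₀ ≤ k) :
    f (x (k + 1)) + (g (x (k + 1))).toReal - (f w + (g w).toReal)
      ≤ ((k : ℝ) + 1) / ((k : ℝ) + 1 - (k₀ : ℝ)) * (α / (μ * ((k : ℝ) + 1) ^ (1 - q)))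
        * realBregman β b' w (x k₀) := by
  have hw' := (M.mem_minimizers_iff hgp).1 hw
  have hμ := M.pos
  have h1 := R.rate M hSC hw'.1 hw'.2.1 (R.min_le M hSC hgp hw) hk₀ hwk hk
  have hd := M.bregman_nonneg hw'.1 (R.mem_inter hSC hk₀)
  have h2 := mul_le_mul_of_nonneg_right (hK (k + 1) (by omega)) hd
  push_cast at h2
  have hk1 : (0 : ℝ) < (k : ℝ) + 1 := by positivity
  have hk2 : (0 : ℝ) < (k : ℝ) + 1 - k₀ := by
    have : (k₀ : ℝ) ≤ k := by exact_mod_cast hk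
    linarith
  have h3 : ((k : ℝ) + 1) ^ (1 - q) * ((k : ℝ) + 1) ^ q = (k : ℝ) + 1 := by
    rw [← Real.rpow_add hk1, sub_add_cancel, Real.rpow_one]
  have hp : (0 : ℝ) < ((k : ℝ) + 1) ^ (1 - q) := Real.rpow_pos_of_pos hk1 _
  rw [div_mul_div_comm, div_mul_eq_mul_div, le_div_iff₀ (by positivity)]
  have h4 := mul_le_mul_of_nonneg_left (h1.trans h2) hp.le
  linear_combination h4 + α * realBregman β b' w (x k₀) * h3

include R M hSC hgp in
lemma tendsto_values {α q : ℝ} (hα : 0 < α) (hq : q < 1) {K : ℕ}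
    (hK : ∀ k, K ≤ k → L k ≤ α * (k : ℝ) ^ q) {w : X} (hw : w ∈ minimizers C f g) {k₀ : ℕ}
    (hk₀ : 1 ≤ k₀) (hKk : K ≤ k₀) (hwk : w ∈ S k₀) :
    Tendsto (fun k => f (x k) + (g (x k)).toReal) atTop (𝓝 (f w + (g w).toReal)) := by
  rw [← tendsto_add_atTop_iff_nat 1, ← tendsto_sub_nhds_zero_iff]
  have hμ := M.pos
  have hw' := (M.mem_minimizers_iff hgp).1 hw
  have hd := M.bregman_nonneg hw'.1 (R.mem_inter hSC hk₀)
  have hlim : Tendsto (fun k : ℕ => 2 * (α / μ) * realBregman β b' w (x k₀) *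
      ((k : ℝ) + 1) ^ (-(1 - q))) atTop (𝓝 0) := by
    have h1 : Tendsto (fun k : ℕ => (k : ℝ) + 1) atTop atTop :=
      tendsto_atTop_add_const_right _ _ tendsto_natCast_atTop_atTop
    simpa using ((tendsto_rpow_neg_atTop (sub_pos.2 hq)).comp h1).const_mul
      (2 * (α / μ) * realBregman β b' w (x k₀))
  refine squeeze_zero' ?_ ?_ hlim
  · filter_upwards [eventually_ge_atTop 1] with k hk
    have := R.min_le M hSC hgp hw k hk
    linarith
  -- From k ≥ 2k₀ on, the prefactor (k + 1)/(k + 1 - k₀) is at most 2.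
  · filter_upwards [eventually_ge_atTop (2 * k₀)] with k hk
    refine (R.rate_of_growth M hSC hgp hK hw hk₀ hKk hwk (by omega)).trans ?_
    have hk' : (2 : ℝ) * k₀ ≤ k := by exact_mod_cast hk
    have hk1 : (0 : ℝ) < (k : ℝ) + 1 := by positivity
    have h0 : (0 : ℝ) ≤ k₀ := by positivity
    have h1 : ((k : ℝ) + 1) / ((k : ℝ) + 1 - k₀) ≤ 2 := by
      rw [div_le_iff₀ (by linarith)]; linarith
    have hp : (0 : ℝ) < ((k : ℝ) + 1) ^ (1 - q) := Real.rpow_pos_of_pos hk1 _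
    calc _ ≤ 2 * (α / (μ * ((k : ℝ) + 1) ^ (1 - q))) * realBregman β b' w (x k₀) := by gcongr
      _ = _ := by rw [Real.rpow_neg hk1.le]; field_simp

include R M hSC hgp in
/-- Weak convergence of the iterates. -/
lemma exists_weaklyTendsto (hX : IsReflexive X) (hminU : minimizers C f g ⊆ U)
    (hb' : WeakToWeakStarSeqContinuousOn b' U)
    (hS : ∀ y ∈ C, ∃ k, 1 ≤ k ∧ y ∈ S k) {w : X} (hw : w ∈ minimizers C f g)
    (hlim : Tendsto (fun k => f (x k) + (g (x k)).toReal) atTop (𝓝 (f w + (g w).toReal))) :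
    ∃ z ∈ minimizers C f g, WeaklyTendsto x z := by
  have hμ := M.pos
  have hanti : ∀ z ∈ minimizers C f g, ∃ k₀, 1 ≤ k₀ ∧
      Antitone fun k => realBregman β b' z (x (k + k₀)) := by
    intro z hz
    have hz' := (M.mem_minimizers_iff hgp).1 hz
    obtain ⟨k₀, hk₀, hzk⟩ := hS z hz'.1
    refine ⟨k₀, hk₀, antitone_nat_of_succ_le fun k => ?_⟩
    have := R.bregman_antitone hμ hz'.2.1 (R.min_le M hSC hgp hz) hk₀ hzk (k := k + k₀) (by omega)
    rwa [show k + 1 + k₀ = k + k₀ + 1 by omega]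
  have hbreg : ∀ z ∈ minimizers C f g, ∃ a, Tendsto (fun k => realBregman β b' z (x k)) atTop
      (𝓝 a) := by
    intro z hz
    obtain ⟨k₀, hk₀, hz'⟩ := hanti z hz
    refine ⟨_, (tendsto_add_atTop_iff_nat k₀).1 (tendsto_atTop_ciInf hz' ⟨0, ?_⟩)⟩
    rintro _ ⟨k, rfl⟩
    exact M.bregman_nonneg hz.1 (R.mem_inter hSC (by omega))
  -- The divergences from `w` converge and dominate (μ/2)‖w - x_k‖².
  have hbdd : ∃ r, ∀ k, ‖x (k + 1)‖ ≤ r := by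
    obtain ⟨a, ha⟩ := hbreg w hw
    obtain ⟨r, hr⟩ := ha.bddAbove_range
    refine ⟨‖w‖ + (1 + r / (μ / 2)), fun k => ?_⟩
    have h1 : realBregman β b' w (x (k + 1)) ≤ r := hr (mem_range_self (k + 1))
    have h2 := (M.sq_norm_le hw.1 (R.mem_inter hSC (k := k + 1) (by omega))).trans h1
    rw [mul_comm, ← le_div_iff₀ (half_pos hμ)] at h2
    have h3 : ‖x (k + 1)‖ ≤ ‖w‖ + ‖w - x (k + 1)‖ := by
      have := norm_sub_le w (w - x (k + 1))
      rwa [sub_sub_cancel] at this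
    nlinarith [sq_nonneg (‖w - x (k + 1)‖ - 1)]
  obtain ⟨r, hr⟩ := hbdd
  -- The shift by 2 keeps to indices at which `g` is known to be finite.
  have hcluster : ∀ (n : ℕ → ℕ) (z : X), Tendsto n atTop atTop →
      WeaklyTendsto (fun i => x (n i + 2)) z → z ∈ minimizers C f g := fun n z hn hz =>
    M.mem_minimizers_of_weaklyTendsto hw hgp (u := fun i => x (n i + 2))
      (fun i => ⟨(R.mem_inter hSC (by omega)).1, R.finite _ (by omega)⟩)
      (hlim.comp ((tendsto_add_atTop_nat 2).comp hn)) hz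
  have hgradlim : ∀ (n : ℕ → ℕ) (z : X), Tendsto n atTop atTop →
      WeaklyTendsto (fun i => x (n i + 2)) z → ∀ v,
      Tendsto (fun i => b' (x (n i + 2)) v) atTop (𝓝 (b' z v)) := fun n z hn hz v =>
    hb' _ z (fun i => (R.mem_inter hSC (by omega)).2) (hminU (hcluster n z hn hz)) hz v
  have hunique : ∀ (n m : ℕ → ℕ) (z v : X), Tendsto n atTop atTop → Tendsto m atTop atTop →
      WeaklyTendsto (fun i => x (n i + 2)) z → WeaklyTendsto (fun i => x (m i + 2)) v → z = v := by
    intro n m z v hn hm hz hv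
    have hzm := hcluster n z hn hz
    have hvm := hcluster m v hm hv
    obtain ⟨a, ha⟩ := hbreg z hzm
    obtain ⟨c, hc⟩ := hbreg v hvm
    -- B(z, x_k) - B(v, x_k) equals β(z) - β(v) - b'(x_k)(z - v), so the gradient term has one limit
    -- along the whole sequence. Both cluster points identify it.
    have hlim : Tendsto (fun k => b' (x k) (z - v)) atTop (𝓝 (β z - β v - (a - c))) := by
      refine ((tendsto_const_nhds (x := β z - β v)).sub (ha.sub hc)).congr fun k => ?_
      have : z - x k = (z - v) + (v - x k) := by abel
      simp only [realBregman, this, map_add]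
      ring
    have h1 := tendsto_nhds_unique (hgradlim n z hn hz (z - v))
      (hlim.comp ((tendsto_add_atTop_nat 2).comp hn))
    have h2 := tendsto_nhds_unique (hgradlim m v hm hv (z - v))
      (hlim.comp ((tendsto_add_atTop_nat 2).comp hm))
    have h3 := M.sq_norm_le hzm.1 ⟨hvm.1, hminU hvm⟩
    have h4 := M.sq_norm_le hvm.1 ⟨hzm.1, hminU hzm⟩
    have h5 : b' z (v - z) = - b' z (z - v) := by rw [← map_neg, neg_sub]
    rw [realBregman] at h3 h4
    rw [norm_sub_rev, h5] at h4
    have h6 : μ * ‖z - v‖ ^ 2 ≤ 0 := by linarith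
    have h7 : ‖z - v‖ ^ 2 ≤ 0 := by
      by_contra h
      exact absurd h6 (not_le.2 (mul_pos hμ (not_le.1 h)))
    have h8 : ‖z - v‖ = 0 := pow_eq_zero_iff two_ne_zero |>.1 (le_antisymm h7 (sq_nonneg _))
    exact sub_eq_zero.1 (norm_eq_zero.1 h8)
  obtain ⟨z, n, hn, hz⟩ := hX.exists_subseq_weaklyTendsto (u := fun k => x (k + 2))
    (fun k => hr (k + 1))
  refine ⟨z, hcluster n z hn.tendsto_atTop hz, fun φ => ?_⟩
  rw [← tendsto_add_atTop_iff_nat 2]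
  refine tendsto_of_subseq_tendsto fun ns hns => ?_
  obtain ⟨v, m, hm, hv⟩ := hX.exists_subseq_weaklyTendsto (u := fun k => x (ns k + 2))
    (fun k => hr (ns k + 1))
  refine ⟨m, ?_⟩
  rw [hunique n (ns ∘ m) z v hn.tendsto_atTop (hns.comp hm.tendsto_atTop) hz hv]
  exact hv φ

include R M hSC hgp in
/-- All convergence properties of the iterates. -/
theorem convergesAlmostSublinearly {b : X → EReal} {α q : ℝ} (hX : IsReflexive X)
    (hbreg : ∀ y ∈ C, ∀ z ∈ U, bregman b b' y z = (realBregman β b' y z : EReal))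
    (hzone : zone b = U) (hmin : (minimizers C f g).Nonempty) (hminU : minimizers C f g ⊆ U)
    (hS : ∀ y ∈ C, ∃ k, 1 ≤ k ∧ y ∈ S k) (hα : 0 < α) (hq : q < 1)
    (hK : ∀ᶠ k : ℕ in atTop, L k ≤ α * (k : ℝ) ^ q) :
    ConvergesAlmostSublinearly b b' f g C μ α q x := by
  obtain ⟨K, hK⟩ := hK.exists_forall_of_atTop
  -- The starting index must come after both the entry of `w` into the sets and the onset of the
  -- growth bound.
  have hindex : ∀ w ∈ C, ∃ k₀, 1 ≤ k₀ ∧ K ≤ k₀ ∧ w ∈ S k₀ := by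
    intro w hw
    obtain ⟨k, hk, hwk⟩ := hS w hw
    exact ⟨max k K, by omega, le_max_right _ _, mono_of_succ R.set_mono hk (le_max_left _ _) hwk⟩
  obtain ⟨w, hw⟩ := hmin
  have hw' := (M.mem_minimizers_iff hgp).1 hw
  obtain ⟨k₀, hk₀, hKk, hwk⟩ := hindex w hw.1
  have hlim := R.tendsto_values M hSC hgp hα hq hK hw hk₀ hKk hwk
  refine ⟨?_, fun v hv => ?_, fun _ hb' => ?_⟩
  · have hinf : (⨅ y ∈ C, objective C f g y) = ((f w + (g w).toReal : ℝ) : EReal) := by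
      rw [← M.objective_eq hw.1 hw'.2.1]
      exact le_antisymm (iInf₂_le w hw.1) (le_iInf₂ fun y hy => hw.2 hy)
    rw [hinf]
    refine ((continuous_coe_real_ereal.tendsto _).comp hlim).congr' ?_
    filter_upwards [eventually_ge_atTop 2] with k hk
    obtain ⟨j, rfl⟩ : ∃ j, k = j + 1 := ⟨k - 1, by omega⟩
    exact (M.objective_eq (R.mem_inter hSC (by omega)).1 (R.finite j (by omega))).symm
  · have hv' := (M.mem_minimizers_iff hgp).1 hv
    obtain ⟨k₁, hk₁, hKk₁, hvk⟩ := hindex v hv.1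
    refine ⟨k₁, hk₁, fun k hk => ?_⟩
    rw [M.objective_eq (R.mem_inter hSC (k := k + 1) (by omega)).1 (R.finite k (by omega)),
      M.objective_eq hv.1 hv'.2.1, hbreg v hv.1 _ (R.mem_inter hSC hk₁).2, ← EReal.coe_sub,
      ← EReal.coe_mul, EReal.coe_le_coe_iff]
    exact R.rate_of_growth M hSC hgp hK hv hk₁ hKk₁ hvk hk
  · rw [hzone] at hb'
    exact R.exists_weaklyTendsto M hSC hgp hX hminU hb' hS hw hlim

end IsDescentRun

end Minimizers

/-! ### Existence of runs for both step size rules. -/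

section Runs

/-- Recursive choice of a sequence indexed from `1` with a given first term. -/
lemma exists_seq_of_step {α : Type*} {A : ℕ → α → Prop} {R : ℕ → α → α → Prop} {a : α}
    (ha : A 1 a) (hstep : ∀ k, 1 ≤ k → ∀ c, A k c → ∃ c', A (k + 1) c' ∧ R k c c') :
    ∃ u : ℕ → α, u 1 = a ∧ ∀ k, 1 ≤ k → A k (u k) ∧ R k (u k) (u (k + 1)) := by
  choose! p hp using fun k c => hstep (k + 1) (Nat.le_add_left 1 k) c
  let v : ℕ → α := fun n => Nat.rec a (fun k c => p k c) n
  have hv : ∀ n, A (n + 1) (v n) := by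
    intro n
    induction n with
    | zero => exact ha
    | succ n ih => exact (hp n _ ih).1
  -- `v n` is the term of index n + 1; truncated subtraction repeats the first term at the
  -- irrelevant index 0.
  refine ⟨fun k => v (k - 1), rfl, fun k hk => ?_⟩
  obtain ⟨j, rfl⟩ : ∃ j, k = j + 1 := ⟨k - 1, by omega⟩
  exact ⟨hv j, (hp j _ (hv j)).2⟩

variable {X : Type*} [NormedAddCommGroup X] [NormedSpace ℝ X]

lemma bestLip_le_iff {f' : X → X →L[ℝ] ℝ} {T : Set X} {K : ℝ} (hK : 0 ≤ K) :
    bestLip f' T ≤ ENNReal.ofReal K ↔ ∀ x ∈ T, ∀ y ∈ T, ‖f' x - f' y‖ ≤ K * ‖x - y‖ := by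
  simp only [bestLip, iSup_le_iff, ENNReal.ofReal_le_ofReal_iff hK]
  refine ⟨fun h x hx y hy => ?_, fun h x hx y hy hxy => ?_⟩
  · rcases eq_or_ne x y with rfl | hxy
    · simp
    · exact (div_le_iff₀ (norm_pos_iff.2 (sub_ne_zero.2 hxy))).1 (h x hx y hy hxy)
  · exact (div_le_iff₀ (norm_pos_iff.2 (sub_ne_zero.2 hxy))).2 (h x hx y hy)

lemma bestLip_le_of_lipschitzOnWith {f' : X → X →L[ℝ] ℝ} {T : Set X} {K : ℝ≥0}
    (h : LipschitzOnWith K f' T) : bestLip f' T ≤ K := by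
  rw [← ENNReal.ofReal_coe_nnreal, bestLip_le_iff K.coe_nonneg]
  intro x hx y hy
  simpa [dist_eq_norm] using h.dist_le_mul x hx y hy

lemma bestLip_mono {f' : X → X →L[ℝ] ℝ} {T T' : Set X} (h : T ⊆ T') :
    bestLip f' T ≤ bestLip f' T' :=
  iSup₂_le fun x hx => iSup₂_le fun y hy => iSup_le fun hxy =>
    le_iSup₂_of_le x (h hx) (le_iSup₂_of_le y (h hy) (le_iSup_of_le hxy le_rfl))

variable {C : Set X} {b : X → EReal} {β : X → ℝ} {b' : X → X →L[ℝ] ℝ} {f : X → ℝ}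
  {f' : X → X →L[ℝ] ℝ} {g : X → EReal} {μ : ℝ} {S : ℕ → Set X}

lemma proxModel_eq
    (hbreg : ∀ y ∈ C, ∀ z ∈ zone b, bregman b b' y z = (realBregman β b' y z : EReal)) {L : ℝ}
    {x y : X} (hx : x ∈ C) (hy : y ∈ zone b) :
    proxModel b b' f f' g L μ x y = (quadModel β b' f f' (L / μ) y x : EReal) + g x := by
  rw [proxModel, hbreg x hx y hy, quadModel, ← EReal.coe_mul, ← EReal.coe_add]

lemma isProxPoint_iff (hSC : ∀ k, 1 ≤ k → S k ⊆ C)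
    (hbreg : ∀ y ∈ C, ∀ z ∈ zone b, bregman b b' y z = (realBregman β b' y z : EReal)) {L : ℝ}
    {k : ℕ} (hk : 1 ≤ k) {y z : X} (hy : y ∈ zone b) :
    IsProxPoint b b' f f' g L μ (S k) y z ↔ z ∈ S k ∧
      IsMinOn (fun x => (quadModel β b' f f' (L / μ) y x : EReal) + g x) (S k) z := by
  refine and_congr_right fun hz => ?_
  rw [isMinOn_iff, isMinOn_iff]
  refine forall₂_congr fun x hx => ?_
  rw [proxModel_eq hbreg (hSC k hk hz) hy, proxModel_eq hbreg (hSC k hk hx) hy]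

lemma IsTelescopic.subset {ν : ℕ → ℝ} (T : IsTelescopic b g C S ν) {k : ℕ} (hk : 1 ≤ k) :
    S k ⊆ C := by
  rw [← T.union]
  exact subset_biUnion_of_mem (u := S) (mem_Ici.2 hk)

lemma IsTelescopic.exists_mem {ν : ℕ → ℝ} (T : IsTelescopic b g C S ν) {y : X} (hy : y ∈ C) :
    ∃ k, 1 ≤ k ∧ y ∈ S k := by
  rw [← T.union] at hy
  simpa using hy

variable (M : IsCompositeModel (zone b) C β b' f f' g μ) (T : IsTelescopic b g C S (fun _ => μ))
  (hbreg : ∀ y ∈ C, ∀ z ∈ zone b, bregman b b' y z = (realBregman β b' y z : EReal))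
  (hP : ProxInZone b b' f f' g S (fun _ => μ))

include M T hbreg in
lemma exists_isProxPoint [CompleteSpace X] {L : ℝ} (hL : 0 < L) {k : ℕ} (hk : 1 ≤ k) {y : X}
    (hy : y ∈ zone b) : ∃ z, IsProxPoint b b' f f' g L μ (S k) y z := by
  obtain ⟨x, hx, hgx⟩ := T.proper
  obtain ⟨z, hz, hz'⟩ := M.exists_prox (T.subset hk) (T.closed k hk) (T.convex k hk)
    ⟨x, mono_of_succ T.mono le_rfl hk hx, hgx⟩ (div_pos hL M.pos) y
  exact ⟨z, (isProxPoint_iff (fun k hk => T.subset hk) hbreg hk hy).2 ⟨hz, hz'⟩⟩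

include M T hbreg in
lemma objective_le_proxModel {L : ℝ} (hL : 0 < L) {k : ℕ} (hk : 1 ≤ k)
    (hLip : ∀ x ∈ S k ∩ zone b, ∀ y ∈ S k ∩ zone b, ‖f' x - f' y‖ ≤ L * ‖x - y‖) {y z : X}
    (hy : y ∈ S k ∩ zone b) (hz : z ∈ S k ∩ zone b) :
    objective C f g z ≤ proxModel b b' f f' g L μ z y := by
  rw [proxModel_eq hbreg (T.subset hk hz.1) hy.2, objective, if_pos (T.subset hk hz.1)]
  exact add_le_add (EReal.coe_le_coe_iff.2
    (M.le_quadModel (T.subset hk) (T.convex k hk) hLip hL.le hy hz)) le_rfl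

include M T hbreg in
lemma isDescentRun_of_steps {L : ℕ → ℝ} {x : ℕ → X}
    (hmem : ∀ k, 1 ≤ k → x k ∈ S k ∩ zone b) (hpos : ∀ k, 1 ≤ k → 0 < L k)
    (hmono : ∀ k, 1 ≤ k → L k ≤ L (k + 1))
    (hstep : ∀ k, 1 ≤ k →
      IsProxPoint b b' f f' g (L (k + 1)) μ (S (k + 1)) (x k) (x (k + 1)))
    (hdesc : ∀ k, 1 ≤ k →
      objective C f g (x (k + 1)) ≤ proxModel b b' f f' g (L (k + 1)) μ (x (k + 1)) (x k)) :
    IsDescentRun (zone b) β b' f g μ S L x := by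
  have key : ∀ k, 1 ≤ k → ∀ w ∈ S (k + 1), g w < ⊤ → g (x (k + 1)) < ⊤ ∧
      f (x (k + 1)) + (g (x (k + 1))).toReal
      + L (k + 1) / μ * (realBregman β b' w (x (k + 1)) - realBregman β b' w (x k))
      ≤ f w + (g w).toReal := by
    intro k hk w hw hgw
    have h1 : 1 ≤ k + 1 := Nat.le_add_left 1 k
    have hx := hmem k hk
    have hx' := hmem (k + 1) h1
    have hd := hdesc k hk
    rw [proxModel_eq hbreg (T.subset h1 hx'.1) hx.2, objective, if_pos (T.subset h1 hx'.1)] at hd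
    exact M.prox_inequality (T.subset h1) (T.convex _ h1) ⟨T.subset hk hx.1, hx.2⟩ hx'
      ((isProxPoint_iff (fun k hk => T.subset hk) hbreg h1 hx.2).1 (hstep k hk)).2 hd hw hgw
  refine ⟨T.mono, hmem, fun k hk => ?_, hpos, hmono, fun k hk w hw hgw => (key k hk w hw hgw).2⟩
  obtain ⟨w, hw, hgw⟩ := T.proper
  exact (key k hk w (mono_of_succ T.mono le_rfl (Nat.le_add_left 1 k) hw) hgw).1

variable {Λ : ℕ → ℝ} (hΛ : ∀ k, 1 ≤ k → 0 < Λ k) (hΛmono : ∀ k, 1 ≤ k → Λ k ≤ Λ (k + 1))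
  (hΛlip : ∀ k, 1 ≤ k → ∀ x ∈ S k ∩ zone b, ∀ y ∈ S k ∩ zone b,
    ‖f' x - f' y‖ ≤ Λ k * ‖x - y‖)

include M T hbreg hP hΛ hΛmono hΛlip in
/-- Existence of runs with the Lipschitz step size rule. -/
lemma exists_lipschitzRun [CompleteSpace X] {x₁ : X} (hx₁ : x₁ ∈ S 1 ∩ zone b) :
    ∃ x : ℕ → X, x 1 = x₁ ∧ IsLipschitzRun b b' f f' g S (fun _ => μ) Λ x ∧
      IsDescentRun (zone b) β b' f g μ S Λ x := by
  obtain ⟨x, hx1, hx⟩ := exists_seq_of_step (A := fun k y => y ∈ S k ∩ zone b)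
    (R := fun k y z => IsProxPoint b b' f f' g (Λ (k + 1)) μ (S (k + 1)) y z) hx₁
    (fun k hk y hy => by
      have hk' : 1 ≤ k + 1 := Nat.le_add_left 1 k
      obtain ⟨z, hz⟩ := exists_isProxPoint M T hbreg (hΛ (k + 1) hk') hk' hy.2
      exact ⟨z, hP _ (hΛ _ hk') _ hk' y ⟨T.mono k hk hy.1, hy.2⟩ z hz, hz⟩)
  refine ⟨x, hx1, ⟨hΛ 1 le_rfl, (bestLip_le_iff (hΛ 1 le_rfl).le).2 (hΛlip 1 le_rfl), ?_, hΛmono,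
    fun k _ => (bestLip_le_iff (hΛ _ (Nat.le_add_left 1 k)).le).2 (hΛlip _ (Nat.le_add_left 1 k)),
    fun k hk => (hx k hk).2⟩, ?_⟩
  · rw [hx1]; exact hx₁
  · refine isDescentRun_of_steps M T hbreg (fun k hk => (hx k hk).1) hΛ hΛmono
      (fun k hk => (hx k hk).2) fun k hk => ?_
    have hk' : 1 ≤ k + 1 := Nat.le_add_left 1 k
    exact objective_le_proxModel M T hbreg (hΛ _ hk') hk' (hΛlip _ hk')
      ⟨T.mono k hk (hx k hk).1.1, (hx k hk).1.2⟩ (hx (k + 1) hk').1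

include M T hbreg hP hΛmono hΛlip in
/-- Existence of runs with the backtracking step size rule, with the bound `η * Λ k` for the step
parameters. -/
lemma exists_backtrackingRun [CompleteSpace X] {x₁ : X} (hx₁ : x₁ ∈ S 1 ∩ zone b) {η : ℝ}
    (hη : 1 < η) {L₁ : ℝ} (hL₁ : 0 < L₁) (hL₁Λ : L₁ ≤ η * Λ 1)
    (hone : (∀ k, 1 ≤ k → S k = C) ∨
      ENNReal.ofReal L₁ ≤ ENNReal.ofReal η * bestLip f' (S 1 ∩ zone b)) :
    ∃ (L : ℕ → ℝ) (x : ℕ → X), x 1 = x₁ ∧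
      IsBacktrackingRun b b' f f' g C η S (fun _ => μ) L x ∧
      IsDescentRun (zone b) β b' f g μ S L x ∧ ∀ k, 1 ≤ k → L k ≤ η * Λ k := by
  have hη0 : 0 < η := zero_lt_one.trans hη
  -- The recursion runs on pairs of a point and a step parameter, with the bound by η Λ_k as part of
  -- the invariant.
  obtain ⟨u, hu1, hu⟩ := exists_seq_of_step (a := (x₁, L₁))
    (A := fun k p => p.1 ∈ S k ∩ zone b ∧ 0 < p.2 ∧ p.2 ≤ η * Λ k)
    (R := fun k p p' => ∃ i : ℕ,
      IsLeast {j : ℕ | ∃ z, IsProxPoint b b' f f' g (η ^ j * p.2) μ (S (k + 1)) p.1 z ∧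
        objective C f g z ≤ proxModel b b' f f' g (η ^ j * p.2) μ z p.1} i ∧
      p'.2 = η ^ i * p.2 ∧
      IsProxPoint b b' f f' g p'.2 μ (S (k + 1)) p.1 p'.1 ∧
      objective C f g p'.1 ≤ proxModel b b' f f' g p'.2 μ p'.1 p.1) ⟨hx₁, hL₁, hL₁Λ⟩ (by
    rintro k hk ⟨y, l⟩ ⟨hy, hl, hlΛ⟩
    have hk' : 1 ≤ k + 1 := Nat.le_add_left 1 k
    have hy' : y ∈ S (k + 1) ∩ zone b := ⟨T.mono k hk hy.1, hy.2⟩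
    simp only at hl hlΛ
    set J := {j : ℕ | ∃ z, IsProxPoint b b' f f' g (η ^ j * l) μ (S (k + 1)) y z ∧
        objective C f g z ≤ proxModel b b' f f' g (η ^ j * l) μ z y} with hJ
    -- By the descent lemma every parameter at least Λ_{k+1} passes the test, so the search
    -- terminates.
    have hmem : ∀ j : ℕ, Λ (k + 1) ≤ η ^ j * l → j ∈ J := by
      intro j hj
      have hpos : 0 < η ^ j * l := by positivity
      obtain ⟨z, hz⟩ := exists_isProxPoint M T hbreg hpos hk' hy.2
      refine ⟨z, hz, objective_le_proxModel M T hbreg hpos hk' (fun v hv w hw => ?_) hy'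
        (hP _ hpos _ hk' y hy' z hz)⟩
      exact (hΛlip _ hk' v hv w hw).trans (mul_le_mul_of_nonneg_right hj (norm_nonneg _))
    have hne : J.Nonempty := by
      obtain ⟨j, hj⟩ := pow_unbounded_of_one_lt (Λ (k + 1) / l) hη
      exact ⟨j, hmem j ((div_le_iff₀ hl).1 hj.le)⟩
    have hleast : IsLeast J (sInf J) := ⟨Nat.sInf_mem hne, fun j hj => Nat.sInf_le hj⟩
    obtain ⟨z, hz, hz'⟩ := hleast.1
    have hpos : 0 < η ^ sInf J * l := by positivity
    refine ⟨(z, η ^ sInf J * l), ⟨hP _ hpos _ hk' y hy' z hz, hpos, ?_⟩, sInf J, hleast, rfl, hz,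
      hz'⟩
    simp only
    -- Without an increase the old bound persists. Otherwise the preceding exponent failed, so its
    -- parameter was below Λ_{k+1}, and the new one exceeds it only by the factor η.
    rcases Nat.eq_zero_or_pos (sInf J) with h0 | h0
    · rw [h0, pow_zero, one_mul]
      exact hlΛ.trans (mul_le_mul_of_nonneg_left (hΛmono k hk) hη0.le)
    · have hnot : sInf J - 1 ∉ J := Nat.notMem_of_lt_sInf (Nat.sub_lt h0 one_pos)
      have h1 : η ^ (sInf J - 1) * l < Λ (k + 1) := by
        by_contra h
        exact hnot (hmem _ (not_lt.1 h))
      have h2 : η ^ sInf J = η * η ^ (sInf J - 1) := by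
        rw [← pow_succ', Nat.sub_add_cancel h0]
      rw [h2, mul_assoc]
      exact mul_le_mul_of_nonneg_left h1.le hη0.le)
  have hstart : x₁ = (u 1).1 := by rw [hu1]
  refine ⟨fun k => (u k).2, fun k => (u k).1, hstart.symm, ⟨by simpa [hu1] using hL₁,
    by simpa [hu1] using hone, by simpa [hu1] using hx₁, fun k hk => ?_⟩,
    isDescentRun_of_steps M T hbreg (fun k hk => (hu k hk).1.1) (fun k hk => (hu k hk).1.2.1)
      (fun k hk => ?_) (fun k hk => ?_) (fun k hk => ?_), fun k hk => (hu k hk).1.2.2⟩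
  · obtain ⟨i, h1, h2, h3, -⟩ := (hu k hk).2
    exact ⟨i, h1, h2, h3⟩
  · obtain ⟨i, -, h2, -, -⟩ := (hu k hk).2
    show (u k).2 ≤ (u (k + 1)).2
    rw [h2]
    exact le_mul_of_one_le_left (hu k hk).1.2.1.le (one_le_pow₀ hη.le)
  · obtain ⟨i, -, -, h3, -⟩ := (hu k hk).2
    exact h3
  · obtain ⟨i, -, -, -, h4⟩ := (hu k hk).2
    exact h4

end Runs

/-! ### Slowing down telescopic sequences. -/

section Telescopes

/-- Every real sequence can be slowed down to be eventually dominated by a given sequence which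
tends to infinity. -/
lemma exists_slow_index (a : ℕ → ℝ) {h : ℕ → ℝ} (hh : Tendsto h atTop atTop) :
    ∃ j : ℕ → ℕ, Monotone j ∧ Tendsto j atTop atTop ∧ ∀ᶠ k in atTop, a (j k) ≤ h k := by
  classical
  -- Demanding the bound for all later indices makes the greatest admissible n ≤ k monotone in k.
  let P : ℕ → ℕ → Prop := fun k n => ∀ k', k ≤ k' → a n ≤ h k'
  have hlim : Tendsto (fun k => Nat.findGreatest (P k) k) atTop atTop := by
    refine tendsto_atTop.2 fun n => ?_
    obtain ⟨N, hN⟩ := (hh.eventually_ge_atTop (a n)).exists_forall_of_atTop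
    filter_upwards [eventually_ge_atTop n, eventually_ge_atTop N] with k hk hk'
    exact Nat.le_findGreatest hk fun k' hkk' => hN k' (hk'.trans hkk')
  refine ⟨fun k => Nat.findGreatest (P k) k, fun k m hkm => ?_, hlim, ?_⟩
  · exact Nat.findGreatest_mono (fun n hn k' hk' => hn k' (hkm.trans hk')) hkm
  -- `Nat.findGreatest` returns 0 also when no index is admissible, so the bound is certain only at
  -- nonzero values.
  · filter_upwards [hlim.eventually_ge_atTop 1] with k hk
    exact Nat.findGreatest_of_ne_zero (P := P k) rfl (by omega) k le_rfl

variable {X : Type*} [NormedAddCommGroup X] [NormedSpace ℝ X] {C : Set X} {b : X → EReal}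
  {b' : X → X →L[ℝ] ℝ} {f : X → ℝ} {f' : X → X →L[ℝ] ℝ} {g : X → EReal} {S : ℕ → Set X}
  {ν : ℕ → ℝ} {μ : ℝ}

lemma StronglyConvexOn.mono {D D' : Set X} (h : StronglyConvexOn D b μ) (hD : D' ⊆ D) :
    StronglyConvexOn D' b μ :=
  ⟨h.1, fun x hx y hy => h.2 x (hD hx) y (hD hy)⟩

/-- Sets may be repeated or skipped as long as the indices increase to infinity. Strong convexity on
all of `C` supplies the constant parameter. -/
lemma IsTelescopic.reindex (T : IsTelescopic b g C S ν) (hμ : StronglyConvexOn C b μ)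
    {j : ℕ → ℕ} (hj1 : ∀ k, 1 ≤ j k) (hj : Monotone j) (hlim : Tendsto j atTop atTop) :
    IsTelescopic b g C (fun k => S (j k)) fun _ => μ where
  closed k _ := T.closed _ (hj1 k)
  convex k _ := T.convex _ (hj1 k)
  nontrivial k _ := T.nontrivial _ (hj1 k)
  mono k _ := mono_of_succ T.mono (hj1 k) (hj (Nat.le_succ k))
  strong k _ := hμ.mono (T.subset (hj1 k))
  param _ _ := le_rfl
  union := by
    refine subset_antisymm (iUnion₂_subset fun k _ => T.subset (hj1 k)) fun y hy => ?_
    obtain ⟨i, hi, hyi⟩ := T.exists_mem hy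
    obtain ⟨k, hk, hk'⟩ := ((hlim.eventually_ge_atTop i).and (eventually_ge_atTop 1)).exists
    exact mem_iUnion₂.2 ⟨k, hk', mono_of_succ T.mono hi hk hyi⟩
  proper := by
    obtain ⟨y, hy, hgy⟩ := T.proper
    exact ⟨y, mono_of_succ T.mono le_rfl (hj1 1) hy, hgy⟩

/-- The proximal point depends on the parameters only through `L / μ`. -/
lemma IsProxPoint.change_parameter {L ρ : ℝ} {D : Set X} {y z : X} (hρ : ρ ≠ 0)
    (h : IsProxPoint b b' f f' g L μ D y z) :
    IsProxPoint b b' f f' g (L / μ * ρ) ρ D y z := by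
  have : L / μ * ρ / ρ = L / μ := mul_div_cancel_right₀ _ hρ
  unfold IsProxPoint proxModel
  rw [this]
  exact h

lemma bestLip_ne_top (hLip : LipschitzOnPieces b f' S) {k : ℕ} (hk : 1 ≤ k) :
    bestLip f' (S k ∩ zone b) ≠ ⊤ := by
  obtain ⟨K, hK⟩ := hLip k hk
  exact ((bestLip_le_of_lipschitzOnWith hK).trans_lt ENNReal.coe_lt_top).ne

lemma norm_sub_le_of_bestLip (hLip : LipschitzOnPieces b f' S) {k : ℕ} (hk : 1 ≤ k) {c : ℝ}
    (hc : (bestLip f' (S k ∩ zone b)).toReal ≤ c) :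
    ∀ x ∈ S k ∩ zone b, ∀ y ∈ S k ∩ zone b, ‖f' x - f' y‖ ≤ c * ‖x - y‖ :=
  (bestLip_le_iff (ENNReal.toReal_nonneg.trans hc)).1
    ((ENNReal.le_ofReal_iff_toReal_le (bestLip_ne_top hLip hk)
      (ENNReal.toReal_nonneg.trans hc)).2 hc)

/-- A telescopic sequence can be slowed down such that the Lipschitz constants of `f'` grow slower
than `k ^ q`. -/
lemma exists_slow_telescopic (T : IsTelescopic b g C S ν) (hLip : LipschitzOnPieces b f' S)
    (hP : ProxInZone b b' f f' g S ν) (hμ : StronglyConvexOn C b μ) {n : ℕ} (hn : 1 ≤ n)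
    {α q η : ℝ} (hα : 0 < α) (hq : 0 < q) :
    ∃ S' : ℕ → Set X, IsTelescopic b g C S' (fun _ => μ) ∧ LipschitzOnPieces b f' S' ∧
      ProxInZone b b' f f' g S' (fun _ => μ) ∧ S n ⊆ S' 1 ∧
      ∀ᶠ k in atTop, η * ((bestLip f' (S' k ∩ zone b)).toReal + 1) ≤ α * (k : ℝ) ^ q := by
  -- The offset n puts `S n` inside the first new set.
  obtain ⟨j, hj, hlim, hslow⟩ := exists_slow_index
    (fun i => η * ((bestLip f' (S (i + n) ∩ zone b)).toReal + 1))
    (h := fun k : ℕ => α * (k : ℝ) ^ q)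
    (((tendsto_rpow_atTop hq).comp tendsto_natCast_atTop_atTop).const_mul_atTop hα)
  have hj1 : ∀ k, 1 ≤ j k + n := fun k => hn.trans (Nat.le_add_left n _)
  refine ⟨fun k => S (j k + n), T.reindex hμ hj1 (fun k m h => Nat.add_le_add_right (hj h) n)
    ((tendsto_add_atTop_nat n).comp hlim), fun k _ => hLip _ (hj1 k), ?_,
    mono_of_succ T.mono hn (Nat.le_add_left n _), hslow⟩
  intro L hL k _ y hy z hz
  have hν := (T.strong _ (hj1 k)).1
  -- The old property is applied with the step parameter (L/μ)ν, which has the same ratio to ν as L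
  -- has to μ.
  exact hP _ (mul_pos (div_pos hL hμ.1) hν) _ (hj1 k) y hy z (hz.change_parameter hν.ne')

/-- If `f'` is constant on the zone then the constant telescopic sequence may be used. -/
lemma isTelescopic_const (T : IsTelescopic b g C S ν) (hP : ProxInZone b b' f f' g S ν)
    (hμ : StronglyConvexOn C b μ) (hC : IsClosed C) (hCc : Convex ℝ C)
    (hLip : LipschitzOnPieces b f' S) (h0 : ∀ k, 1 ≤ k → bestLip f' (S k ∩ zone b) = 0) :
    IsTelescopic b g C (fun _ => C) (fun _ => μ) ∧
      ProxInZone b b' f f' g (fun _ => C) (fun _ => μ) ∧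
      ∀ x ∈ C ∩ zone b, ∀ y ∈ C ∩ zone b, f' x = f' y := by
  have hcommon : ∀ x ∈ C, ∀ y ∈ C, ∃ k, 1 ≤ k ∧ x ∈ S k ∧ y ∈ S k := by
    intro x hx y hy
    obtain ⟨i, hi, hxi⟩ := T.exists_mem hx
    obtain ⟨j, hj, hyj⟩ := T.exists_mem hy
    exact ⟨max i j, hi.trans (le_max_left _ _), mono_of_succ T.mono hi (le_max_left _ _) hxi,
      mono_of_succ T.mono hj (le_max_right _ _) hyj⟩
  refine ⟨⟨fun _ _ => hC, fun _ _ => hCc, fun _ _ => (T.nontrivial 1 le_rfl).mono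
    (inter_subset_inter_left _ (T.subset le_rfl)), fun _ _ => subset_rfl, fun _ _ => hμ,
    fun _ _ => le_rfl, biUnion_const ⟨1, mem_Ici.2 le_rfl⟩ C, ?_⟩, ?_, ?_⟩
  · obtain ⟨y, hy, hgy⟩ := T.proper
    exact ⟨y, T.subset le_rfl hy, hgy⟩
  · intro L hL _ _ y hy z hz
    -- A minimizer over `C` also minimizes over any piece containing it, where the given property
    -- applies.
    obtain ⟨k, hk, hyk, hzk⟩ := hcommon y hy.1 z hz.1
    have hν := (T.strong k hk).1
    have hz' : IsProxPoint b b' f f' g L μ (S k) y z :=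
      ⟨hzk, hz.2.on_subset (T.subset hk)⟩
    exact ⟨hz.1, (hP _ (mul_pos (div_pos hL hμ.1) hν) k hk y ⟨hyk, hy.2⟩ z
      (hz'.change_parameter hν.ne')).2⟩
  · intro x hx y hy
    obtain ⟨k, hk, hxk, hyk⟩ := hcommon x hx.1 y hy.1
    have := norm_sub_le_of_bestLip hLip hk (c := 0) (by simp [h0 k hk]) x ⟨hxk, hx.2⟩ y
      ⟨hyk, hy.2⟩
    rw [zero_mul] at this
    exact sub_eq_zero.1 (norm_le_zero_iff.1 this)

/-- The telescopic sequence of intersections with balls. -/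
lemma isTelescopic_closedBall (hC : IsClosed C) (hCc : Convex ℝ C) (hμ : StronglyConvexOn C b μ)
    {w p : X} (hw : w ∈ C ∩ zone b) (hp : p ∈ C ∩ zone b) (hwp : p ≠ w) (hgw : g w < ⊤) :
    IsTelescopic b g C (fun k => C ∩ Metric.closedBall w (‖p - w‖ + k)) (fun _ => μ) where
  closed _ _ := hC.inter Metric.isClosed_closedBall
  convex _ _ := hCc.inter (convex_closedBall _ _)
  nontrivial k _ := ⟨p, ⟨⟨hp.1, by simp [dist_eq_norm]⟩, hp.2⟩, w,
    ⟨⟨hw.1, Metric.mem_closedBall_self (by positivity)⟩, hw.2⟩, hwp⟩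
  mono k _ := inter_subset_inter_right _ (Metric.closedBall_subset_closedBall (by simp))
  strong _ _ := hμ.mono inter_subset_left
  param _ _ := le_rfl
  union := by
    refine subset_antisymm (iUnion₂_subset fun k _ => inter_subset_left) fun y hy => ?_
    obtain ⟨k, hk⟩ := exists_nat_ge (dist y w)
    refine mem_iUnion₂.2 ⟨k + 1, mem_Ici.2 (Nat.le_add_left 1 k), hy, ?_⟩
    rw [Metric.mem_closedBall]
    push_cast
    have := norm_nonneg (p - w)
    linarith
  proper := ⟨w, ⟨hw.1, Metric.mem_closedBall_self (by positivity)⟩, hgw⟩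

end Telescopes

/-! ### Passage from `b` to a real-valued kernel. -/

section SemiBregman

variable {X : Type*} [NormedAddCommGroup X] [NormedSpace ℝ X] {b : X → EReal}
  {b' : X → X →L[ℝ] ℝ}

namespace IsSemiBregman

variable (hb : IsSemiBregman b b')
include hb

lemma coe_toReal {x : X} (hx : x ∈ dom b) : ((b x).toReal : EReal) = b x :=
  EReal.coe_toReal (ne_of_lt hx) (hb.ne_bot x)

lemma combo_le {x y : X} (hx : x ∈ dom b) (hy : y ∈ dom b) {l : ℝ} (hl : 0 < l) (hl' : l < 1) :
    b (l • x + (1 - l) • y) ≤ ((l * (b x).toReal + (1 - l) * (b y).toReal : ℝ) : EReal) := by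
  have := hb.convex x (mem_univ x) y (mem_univ y) l hl hl'
  rw [← hb.coe_toReal hx, ← hb.coe_toReal hy] at this
  exact_mod_cast this

lemma convexOn_toReal : ConvexOn ℝ (dom b) fun x => (b x).toReal := by
  have hmem : ∀ x ∈ dom b, ∀ y ∈ dom b, ∀ l : ℝ, 0 < l → l < 1 →
      l • x + (1 - l) • y ∈ dom b := fun x hx y hy l hl hl' =>
    (hb.combo_le hx hy hl hl').trans_lt (EReal.coe_lt_top _)
  refine convexOn_iff_forall_pos.2 ⟨convex_iff_forall_pos.2 fun x hx y hy a c ha hc hac => ?_,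
    fun x hx y hy a c ha hc hac => ?_⟩
  · obtain rfl : c = 1 - a := by linarith
    exact hmem x hx y hy a ha (by linarith)
  · obtain rfl : c = 1 - a := by linarith
    have h1 := hb.combo_le hx hy ha (by linarith)
    rw [← hb.coe_toReal (hmem x hx y hy a ha (by linarith)), EReal.coe_le_coe_iff] at h1
    exact h1

lemma bregman_eq {x y : X} (hx : x ∈ dom b) (hy : y ∈ zone b) :
    bregman b b' x y = (realBregman (fun x => (b x).toReal) b' x y : EReal) := by
  rw [bregman, if_pos ⟨hx, hy⟩, ← hb.coe_toReal hx, ← hb.coe_toReal (interior_subset hy),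
    ← EReal.coe_sub, ← EReal.coe_sub]
  rfl

lemma isCompositeModel {C : Set X} (hC_dom : C ⊆ dom b) (hC : IsClosed C) (hCc : Convex ℝ C)
    {f : X → ℝ} {f' : X → X →L[ℝ] ℝ} (hf : ConvexOn ℝ (dom b) f)
    (hf' : ∀ x ∈ zone b, HasGateauxDerivAt f (f' x) x) (hf_lsc : LowerSemicontinuousOn f C)
    {g : X → EReal} (hg_bot : ∀ x ∈ C, g x ≠ ⊥) (hg : EConvexOn C g)
    (hg_lsc : LowerSemicontinuousOn g C) {μ : ℝ} (hμ : StronglyConvexOn C b μ) :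
    IsCompositeModel (zone b) C (fun x => (b x).toReal) b' f f' g μ where
  zone_convex := hb.convexOn_toReal.1.interior
  closed := hC
  convex := hCc
  pos := hμ.1
  kernel_strong x hx y hy l hl hl' := by
    have h1 := hμ.2 x hx y hy l hl hl'
    have hmem : l • x + (1 - l) • y ∈ C := hCc hx hy hl.le (by linarith) (by ring)
    rw [← hb.coe_toReal (hC_dom hx), ← hb.coe_toReal (hC_dom hy),
      ← hb.coe_toReal (hC_dom hmem)] at h1
    have h2 : (b (l • x + (1 - l) • y)).toReal + l * (1 - l) * (1 / 2 * μ * ‖x - y‖ ^ 2)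
        ≤ l * (b x).toReal + (1 - l) * (b y).toReal := by exact_mod_cast h1
    linear_combination h2
  kernel_lsc x hx c hc := by
    have h1 : (c : EReal) < b x := by
      rw [← hb.coe_toReal (hC_dom hx)]
      exact EReal.coe_lt_coe_iff.2 hc
    filter_upwards [mem_nhdsWithin_of_mem_nhds (hb.lsc x _ h1), self_mem_nhdsWithin] with y hy hyC
    have h2 : (c : EReal) < b y := hy
    rw [← hb.coe_toReal (hC_dom hyC)] at h2
    exact EReal.coe_lt_coe_iff.1 h2
  kernel_grad := hb.gateaux
  smooth_convex := hf.subset hC_dom hCc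
  smooth_lsc := hf_lsc
  smooth_grad := hf'
  ne_bot := hg_bot
  econvex := hg
  lsc := hg_lsc

end IsSemiBregman

end SemiBregman

/-! ### Gauges built from second differences. -/

section UniformConvexity

variable {X : Type*} [NormedAddCommGroup X] [NormedSpace ℝ X]

/-- The second difference of `β` with end points `x`, `y`. -/
noncomputable def secondDiff (β : X → ℝ) (x y : X) : ℝ :=
  β x + β y - 2 * β ((1 / 2 : ℝ) • x + (1 / 2 : ℝ) • y)

/-- The smallest second difference over pairs of points of `U` at distance `t`. -/
noncomputable def secondDiffModulus (β : X → ℝ) (U : Set X) (t : ℝ≥0) : ℝ≥0∞ :=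
  ⨅ (x ∈ U) (y ∈ U) (_ : ‖x - y‖₊ = t), ENNReal.ofReal (secondDiff β x y)

variable {β : X → ℝ} {U D : Set X}

lemma secondDiffModulus_le {x y : X} (hx : x ∈ U) (hy : y ∈ U) :
    secondDiffModulus β U ‖x - y‖₊ ≤ ENNReal.ofReal (secondDiff β x y) :=
  iInf₂_le_of_le x hx (iInf₂_le_of_le y hy (iInf_le _ rfl))

lemma convexOn_combo_le (hβ : ConvexOn ℝ D β) {x y : X} (hx : x ∈ D) (hy : y ∈ D) {a c : ℝ}
    (ha : 0 ≤ a) (hc : 0 ≤ c) (hac : a + c = 1) : β (a • x + c • y) ≤ a * β x + c * β y :=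
  hβ.2 hx hy ha hc hac

/-- Shrinking a segment about its midpoint leaves the midpoint value unchanged and, by convexity,
does not increase the sum of the end values. -/
lemma secondDiff_inner_le (hβ : ConvexOn ℝ D β) {x y : X} (hx : x ∈ D) (hy : y ∈ D) {s : ℝ}
    (hs0 : 0 ≤ s) (hs1 : s ≤ 1) :
    secondDiff β (((1 + s) / 2) • x + ((1 - s) / 2) • y) (((1 - s) / 2) • x + ((1 + s) / 2) • y)
      ≤ secondDiff β x y := by
  have h1 := convexOn_combo_le hβ hx hy (a := (1 + s) / 2) (c := (1 - s) / 2) (by linarith) (by linarith) (by ring)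
  have h2 := convexOn_combo_le hβ hx hy (a := (1 - s) / 2) (c := (1 + s) / 2) (by linarith) (by linarith) (by ring)
  have h3 : (1 / 2 : ℝ) • (((1 + s) / 2) • x + ((1 - s) / 2) • y)
      + (1 / 2 : ℝ) • (((1 - s) / 2) • x + ((1 + s) / 2) • y)
      = (1 / 2 : ℝ) • x + (1 / 2 : ℝ) • y := by module
  simp only [secondDiff, h3]
  linarith

lemma nnnorm_inner_sub (x y : X) (s : ℝ≥0) :
    ‖((1 + (s : ℝ)) / 2) • x + ((1 - (s : ℝ)) / 2) • y
      - (((1 - (s : ℝ)) / 2) • x + ((1 + (s : ℝ)) / 2) • y)‖₊ = s * ‖x - y‖₊ := by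
  have : ((1 + (s : ℝ)) / 2) • x + ((1 - (s : ℝ)) / 2) • y
      - (((1 - (s : ℝ)) / 2) • x + ((1 + (s : ℝ)) / 2) • y) = (s : ℝ) • (x - y) := by module
  rw [this, nnnorm_smul, NNReal.nnnorm_eq]

/-- A pair at distance t shrinks about its midpoint to a pair at any smaller distance. -/
lemma secondDiffModulus_mono (hβ : ConvexOn ℝ U β) : Monotone (secondDiffModulus β U) := by
  intro r t hrt
  refine le_iInf₂ fun x hx => le_iInf₂ fun y hy => le_iInf fun ht => ?_
  obtain ⟨s, hs1, rfl⟩ : ∃ s : ℝ≥0, s ≤ 1 ∧ r = s * t := by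
    rcases eq_or_ne t 0 with rfl | h0
    · exact ⟨1, le_rfl, by simpa using hrt⟩
    · exact ⟨r / t, div_le_one_of_le₀ hrt zero_le, (div_mul_cancel₀ r h0).symm⟩
  have hs1' : (s : ℝ) ≤ 1 := by exact_mod_cast hs1
  have hs0 : (0 : ℝ) ≤ s := s.coe_nonneg
  have hp : ((1 + (s : ℝ)) / 2) • x + ((1 - (s : ℝ)) / 2) • y ∈ U :=
    hβ.1 hx hy (by linarith) (by linarith) (by ring)
  have hq : ((1 - (s : ℝ)) / 2) • x + ((1 + (s : ℝ)) / 2) • y ∈ U :=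
    hβ.1 hx hy (by linarith) (by linarith) (by ring)
  rw [← ht, ← nnnorm_inner_sub x y s]
  exact (secondDiffModulus_le hp hq).trans
    (ENNReal.ofReal_le_ofReal (secondDiff_inner_le hβ hx hy hs0 hs1'))

lemma secondDiff_nonneg (hβ : ConvexOn ℝ U β) {x y : X} (hx : x ∈ U) (hy : y ∈ U) :
    0 ≤ secondDiff β x y := by
  have := convexOn_combo_le hβ hx hy (a := 1 / 2) (c := 1 / 2) (by norm_num) (by norm_num) (by norm_num)
  rw [secondDiff]
  linarith

/-- With the quarter points of a segment, its second difference is the sum, with weights 1, 2, 1, of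
those of three subsegments of half the length. -/
lemma four_mul_secondDiffModulus_le (hβ : ConvexOn ℝ U β) (t : ℝ≥0) :
    4 * secondDiffModulus β U t ≤ secondDiffModulus β U (2 * t) := by
  refine le_iInf₂ fun x hx => le_iInf₂ fun y hy => le_iInf fun ht => ?_
  set m := (1 / 2 : ℝ) • x + (1 / 2 : ℝ) • y with hm
  set p := (3 / 4 : ℝ) • x + (1 / 4 : ℝ) • y with hp
  set r := (1 / 4 : ℝ) • x + (3 / 4 : ℝ) • y with hr
  have hmU : m ∈ U := hβ.1 hx hy (by norm_num) (by norm_num) (by norm_num)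
  have hpU : p ∈ U := hβ.1 hx hy (by norm_num) (by norm_num) (by norm_num)
  have hrU : r ∈ U := hβ.1 hx hy (by norm_num) (by norm_num) (by norm_num)
  have hdist : ∀ u v : X, u - v = (1 / 2 : ℝ) • (x - y) → ‖u - v‖₊ = t := by
    intro u v huv
    rw [huv, nnnorm_smul, ht]
    ext
    push_cast
    rw [Real.norm_of_nonneg (by norm_num)]
    ring
  have h1 := secondDiffModulus_le (β := β) hx hmU
  have h2 := secondDiffModulus_le (β := β) hpU hrU
  have h3 := secondDiffModulus_le (β := β) hmU hy
  rw [hdist x m (by rw [hm]; module)] at h1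
  rw [hdist p r (by rw [hp, hr]; module)] at h2
  rw [hdist m y (by rw [hm]; module)] at h3
  have hsum : secondDiff β x y
      = secondDiff β x m + (secondDiff β p r + secondDiff β p r) + secondDiff β m y := by
    have e1 : (1 / 2 : ℝ) • x + (1 / 2 : ℝ) • m = p := by rw [hm, hp]; module
    have e2 : (1 / 2 : ℝ) • p + (1 / 2 : ℝ) • r = m := by rw [hm, hp, hr]; module
    have e3 : (1 / 2 : ℝ) • m + (1 / 2 : ℝ) • y = r := by rw [hm, hr]; module
    simp only [secondDiff, e1, e2, e3, ← hm]
    ring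
  have n1 := secondDiff_nonneg hβ hx hmU
  have n2 := secondDiff_nonneg hβ hpU hrU
  have n3 := secondDiff_nonneg hβ hmU hy
  rw [hsum, ENNReal.ofReal_add (by positivity) n3, ENNReal.ofReal_add n1 (by positivity),
    ENNReal.ofReal_add n2 n2]
  calc 4 * secondDiffModulus β U t
      = secondDiffModulus β U t + (secondDiffModulus β U t + secondDiffModulus β U t)
        + secondDiffModulus β U t := by ring
    _ ≤ _ := by gcongr

/-- The supremum s of the modulus is positive and satisfies 4s ≤ s, so it is infinite. -/
lemma tendsto_secondDiffModulus (hβ : ConvexOn ℝ U β) (hpos : 0 < secondDiffModulus β U 1) :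
    Tendsto (secondDiffModulus β U) atTop (𝓝 ⊤) := by
  have hlim := tendsto_atTop_iSup (secondDiffModulus_mono hβ)
  obtain ⟨s, hs⟩ : ∃ s, s = ⨆ t, secondDiffModulus β U t := ⟨_, rfl⟩
  rw [← hs] at hlim
  have h4 : 4 * s ≤ s := by
    rw [hs, ENNReal.mul_iSup]
    exact iSup_le fun t => (four_mul_secondDiffModulus_le hβ t).trans (le_iSup _ (2 * t))
  have hs0 : s ≠ 0 := by
    rw [hs]; exact (hpos.trans_le (le_iSup (secondDiffModulus β U) 1)).ne'
  clear hs
  have : s = ⊤ := by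
    clear hlim
    by_contra hne
    lift s to ℝ≥0 using hne
    have h5 : (4 : ℝ≥0) * s ≤ s := by exact_mod_cast h4
    have h6 : s ≠ 0 := by exact_mod_cast hs0
    have h7 : (4 : ℝ) * s ≤ s := by exact_mod_cast h5
    have h8 : (0 : ℝ) < s := by exact_mod_cast pos_iff_ne_zero.2 h6
    linarith
  rwa [this] at hlim

/-- For l ≤ 1/2 the point lies between the midpoint and `y`, and convexity there gains l times the
second difference, hence l(1 - l) times it. The other half is symmetric. -/
lemma mul_secondDiff_le (hβ : ConvexOn ℝ D β) {x y : X} (hx : x ∈ D) (hy : y ∈ D) {l : ℝ}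
    (hl : 0 < l) (hl' : l < 1) :
    β (l • x + (1 - l) • y) + l * (1 - l) * secondDiff β x y ≤ l * β x + (1 - l) * β y := by
  have hm : (1 / 2 : ℝ) • x + (1 / 2 : ℝ) • y ∈ D :=
    hβ.1 hx hy (by norm_num) (by norm_num) (by norm_num)
  have h0 := secondDiff_nonneg hβ hx hy
  rcases le_total l (1 / 2) with h | h
  · have h1 := convexOn_combo_le hβ hm hy (a := 2 * l) (c := 1 - 2 * l) (by linarith) (by linarith) (by ring)
    have h2 : (2 * l) • ((1 / 2 : ℝ) • x + (1 / 2 : ℝ) • y) + (1 - 2 * l) • y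
        = l • x + (1 - l) • y := by module
    rw [h2] at h1
    rw [secondDiff] at h0 ⊢
    have h3 := mul_nonneg (mul_nonneg hl.le hl.le) h0
    linear_combination h1 + h3
  · have h1 := convexOn_combo_le hβ hm hx (a := 2 * (1 - l)) (c := 1 - 2 * (1 - l)) (by linarith) (by linarith)
      (by ring)
    have h2 : (2 * (1 - l)) • ((1 / 2 : ℝ) • x + (1 / 2 : ℝ) • y) + (1 - 2 * (1 - l)) • x
        = l • x + (1 - l) • y := by module
    rw [h2] at h1
    rw [secondDiff] at h0 ⊢
    have h3 := mul_nonneg (mul_nonneg (sub_pos.2 hl').le (sub_pos.2 hl').le) h0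
    linear_combination h1 + h3

/-- Uniform convexity on the zone implies relative uniform convexity from the points of the domain
with gauges tending to infinity. -/
theorem IsSemiBregman.relativelyUniformlyConvexFromPoints {b : X → EReal} {b' : X → X →L[ℝ] ℝ}
    (hb : IsSemiBregman b b') {C : Set X} (hC_dom : C ⊆ dom b)
    (hU : UniformlyConvexOn (zone b) b) : RelativelyUniformlyConvexFromPoints b C := by
  obtain ⟨ψ, hψpos, hψ⟩ := hU
  set β : X → ℝ := fun x => (b x).toReal with hβdef
  have hβ : ConvexOn ℝ (dom b) β := hb.convexOn_toReal
  have hβU : ConvexOn ℝ (zone b) β := hβ.subset interior_subset hβ.1.interior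
  have hpos : ∀ t, 0 < t → 0 < secondDiffModulus β (zone b) t := by
    intro t ht
    -- Uniform convexity at the midpoint bounds the second difference below by ψ(t)/2.
    refine lt_of_lt_of_le (ENNReal.half_pos (hψpos t ht).ne') ?_
    refine le_iInf₂ fun x hx => le_iInf₂ fun y hy => le_iInf fun hxy => ?_
    have h1 := hψ x hx y hy (1 / 2) (by norm_num) (by norm_num)
    have hm : (1 / 2 : ℝ) • x + (1 - 1 / 2 : ℝ) • y ∈ dom b :=
      hβ.1 (interior_subset hx) (interior_subset hy) (by norm_num) (by norm_num) (by norm_num)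
    rw [hxy, ← hb.coe_toReal (interior_subset hx), ← hb.coe_toReal (interior_subset hy),
      ← hb.coe_toReal hm] at h1
    have hne : ψ t ≠ ⊤ := by
      intro h
      rw [h, EReal.coe_ennreal_top, EReal.coe_mul_top_of_pos (by norm_num),
        EReal.coe_add_top] at h1
      refine absurd h1 (not_le.2 ?_)
      exact_mod_cast EReal.coe_lt_top _
    lift ψ t to ℝ≥0 using hne with c hc
    have h2 : β ((1 / 2 : ℝ) • x + (1 - 1 / 2 : ℝ) • y) + 1 / 2 * (1 - 1 / 2) * (c : ℝ)
        ≤ 1 / 2 * β x + (1 - 1 / 2) * β y := by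
      rw [EReal.coe_nnreal_eq_coe_real, ← EReal.coe_mul, ← EReal.coe_mul, ← EReal.coe_mul,
        ← EReal.coe_add, ← EReal.coe_add, EReal.coe_le_coe_iff] at h1
      exact h1
    rw [← ENNReal.ofReal_coe_nnreal, ← ENNReal.ofReal_ofNat,
      ← ENNReal.ofReal_div_of_pos (by norm_num)]
    refine ENNReal.ofReal_le_ofReal ?_
    rw [secondDiff]
    norm_num at h2 ⊢
    linarith
  intro x hx
  -- `x` may lie on the boundary of the domain, but the middle half of the segment from `x` to `y`
  -- has both ends in the zone. This is the origin of the factor 1/2.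
  refine ⟨0, le_rfl, ?_, fun t => secondDiffModulus β (zone b) (1 / 2 * t), ⟨fun t ht =>
    hpos _ (by positivity), ?_⟩, ?_⟩
  · obtain ⟨y, hy⟩ := hb.zone_nonempty
    exact ⟨y, hy, norm_nonneg y⟩
  · rintro _ rfl y ⟨hy, -⟩ l hl hl'
    rename_i x
    have hxD := hC_dom hx
    have hyD : y ∈ dom b := interior_subset hy
    have hp : ((1 + ((1 / 2 : ℝ≥0) : ℝ)) / 2) • x + ((1 - ((1 / 2 : ℝ≥0) : ℝ)) / 2) • y
        ∈ zone b := by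
      rw [add_comm]
      exact hβ.1.combo_interior_self_mem_interior hy hxD (by norm_num) (by norm_num) (by norm_num)
    have hq : ((1 - ((1 / 2 : ℝ≥0) : ℝ)) / 2) • x + ((1 + ((1 / 2 : ℝ≥0) : ℝ)) / 2) • y
        ∈ zone b := by
      rw [add_comm]
      exact hβ.1.combo_interior_self_mem_interior hy hxD (by norm_num) (by norm_num) (by norm_num)
    have h1 := secondDiffModulus_le (β := β) hp hq
    rw [nnnorm_inner_sub] at h1
    have h2 := h1.trans (ENNReal.ofReal_le_ofReal
      (secondDiff_inner_le hβ hxD hyD (by norm_num) (by norm_num)))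
    have h3 : ((secondDiffModulus β (zone b) (1 / 2 * ‖x - y‖₊) : ℝ≥0∞) : EReal)
        ≤ (secondDiff β x y : EReal) := by
      refine (EReal.coe_ennreal_le_coe_ennreal_iff.2 h2).trans_eq ?_
      rw [EReal.coe_ennreal_ofReal, max_eq_left (secondDiff_nonneg hβ hxD hyD)]
    have h4 := mul_secondDiff_le hβ hxD hyD hl hl'
    have hm : l • x + (1 - l) • y ∈ dom b := hβ.1 hxD hyD hl.le (by linarith) (by ring)
    have h5 : 0 ≤ l * (1 - l) := mul_nonneg hl.le (by linarith)
    refine (add_le_add le_rfl (mul_le_mul_of_nonneg_left h3 (EReal.coe_nonneg.2 h5))).trans ?_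
    rw [← hb.coe_toReal hxD, ← hb.coe_toReal hyD, ← hb.coe_toReal hm]
    exact_mod_cast h4
  · refine (tendsto_secondDiffModulus hβU (hpos 1 one_pos)).comp
      (tendsto_atTop_atTop.2 fun c => ⟨2 * c, fun a ha => ?_⟩)
    rw [one_div, ← div_eq_inv_mul, le_div_iff₀ two_pos, mul_comm]
    exact ha

end UniformConvexity

/-! ### The slowed-down sequences for the two rules. -/

section Rules

variable {X : Type*} [NormedAddCommGroup X] [NormedSpace ℝ X]
  {b : X → EReal} {b' : X → X →L[ℝ] ℝ} {C : Set X} {f : X → ℝ} {f' : X → X →L[ℝ] ℝ}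
  {g : X → EReal} {μ : ℝ} {S : ℕ → Set X} {ν : ℕ → ℝ}

/-- A telescopic sequence with Lipschitz gradients and proximal points in the zone exists under
either form of the assumption on the proximal points. -/
lemma exists_telescopic {f'' : X → X →L[ℝ] X →L[ℝ] ℝ} (hb : IsSemiBregman b b')
    (hC_dom : C ⊆ dom b) (hC : IsClosed C) (hCc : Convex ℝ C) (hC_nontrivial : C.Nontrivial)
    (hμ : StronglyConvexOn C b μ) {w : X} (hw : w ∈ C ∩ zone b) (hgw : g w < ⊤)
    (hprox :
      (∀ (S : ℕ → Set X) (ν : ℕ → ℝ), IsTelescopic b g C S ν → LipschitzOnPieces b f' S →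
          (∃ x ∈ S 1 ∩ zone b, g x < ⊤) → ProxInZone b b' f f' g S ν) ∨
      (∃ (S : ℕ → Set X) (ν : ℕ → ℝ), IsTelescopic b g C S ν ∧ LipschitzOnPieces b f' S ∧
        ProxInZone b b' f f' g S ν))
    (hf_second : ∀ x ∈ C ∩ zone b, HasGateauxDerivAt f' (f'' x) x)
    (hf_bdd : ∀ D ⊆ C ∩ zone b, Bornology.IsBounded D → ∃ M : ℝ, ∀ x ∈ D, ‖f'' x‖ ≤ M) :
    ∃ (S : ℕ → Set X) (ν : ℕ → ℝ), IsTelescopic b g C S ν ∧ LipschitzOnPieces b f' S ∧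
      ProxInZone b b' f f' g S ν := by
  rcases hprox with hprox | h
  swap
  · exact h
  have hdom := hb.convexOn_toReal.1
  obtain ⟨c, hc, hcw⟩ := hC_nontrivial.exists_ne w
  -- The midpoint of a zone point and a domain point is in the zone; it serves as the second zone
  -- point common to all the balls.
  have hp : (1 / 2 : ℝ) • w + (1 / 2 : ℝ) • c ∈ C ∩ zone b :=
    ⟨hCc hw.1 hc (by norm_num) (by norm_num) (by norm_num),
      hdom.combo_interior_self_mem_interior hw.2 (hC_dom hc) (by norm_num) (by norm_num)
        (by norm_num)⟩
  have hpw : (1 / 2 : ℝ) • w + (1 / 2 : ℝ) • c ≠ w := by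
    intro h
    have h1 : (1 / 2 : ℝ) • (c - w) = 0 := by
      have : (1 / 2 : ℝ) • (c - w) = (1 / 2 : ℝ) • w + (1 / 2 : ℝ) • c - w := by module
      rw [this, h, sub_self]
    rcases smul_eq_zero.1 h1 with h2 | h2
    · norm_num at h2
    · exact hcw (sub_eq_zero.1 h2)
  have T := isTelescopic_closedBall hC hCc hμ hw hp hpw hgw
  have hLip : LipschitzOnPieces b f'
      (fun k : ℕ => C ∩ Metric.closedBall w (‖(1 / 2 : ℝ) • w + (1 / 2 : ℝ) • c - w‖ + k)) := by
    intro k hk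
    obtain ⟨K, hK⟩ := hf_bdd _ (inter_subset_inter_left (zone b) inter_subset_left)
      (Metric.isBounded_closedBall.subset ((inter_subset_left (t := zone b)).trans
        (inter_subset_right (s := C) (t := Metric.closedBall w
          (‖(1 / 2 : ℝ) • w + (1 / 2 : ℝ) • c - w‖ + k)))))
    exact ⟨K.toNNReal, lipschitzOnWith_of_gateaux_bounded ((T.convex k hk).inter hdom.interior)
      (fun x hx => hf_second x ⟨hx.1.1, hx.2⟩) fun x hx => (hK x hx).trans (Real.le_coe_toNNReal K)⟩
  exact ⟨_, _, T, hLip, hprox _ _ T hLip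
    ⟨w, ⟨⟨hw.1, Metric.mem_closedBall_self (by positivity)⟩, hw.2⟩, hgw⟩⟩

variable (hX : IsReflexive X) (hb : IsSemiBregman b b') (hC_dom : C ⊆ dom b)
  (M : IsCompositeModel (zone b) C (fun x => (b x).toReal) b' f f' g μ)
  (hμ : StronglyConvexOn C b μ)
  (hmin : (minimizers C f g).Nonempty) (hmin_zone : minimizers C f g ⊆ zone b)
  (T : IsTelescopic b g C S ν) (hLip : LipschitzOnPieces b f' S)
  (hP : ProxInZone b b' f f' g S ν) {α q : ℝ} (hα : 0 < α) (hq : 0 < q) (hq' : q < 1)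

/-- The added 1 keeps the step parameters positive even where `f'` is constant. -/
lemma pos_bestLip_bound (T : IsTelescopic b g C S ν) (hLip : LipschitzOnPieces b f' S) :
    (∀ k, 1 ≤ k → 0 < (bestLip f' (S k ∩ zone b)).toReal + 1) ∧
    (∀ k, 1 ≤ k → (bestLip f' (S k ∩ zone b)).toReal + 1
      ≤ (bestLip f' (S (k + 1) ∩ zone b)).toReal + 1) ∧
    ∀ k, 1 ≤ k → ∀ x ∈ S k ∩ zone b, ∀ y ∈ S k ∩ zone b,
      ‖f' x - f' y‖ ≤ ((bestLip f' (S k ∩ zone b)).toReal + 1) * ‖x - y‖ := by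
  refine ⟨fun k _ => by positivity, fun k hk => ?_, fun k hk =>
    norm_sub_le_of_bestLip hLip hk (le_add_of_nonneg_right zero_le_one)⟩
  gcongr
  · exact bestLip_ne_top hLip (Nat.le_add_left 1 k)
  · exact bestLip_mono (inter_subset_inter_left _ (T.mono k hk))

include hX hb hC_dom M hμ hmin hmin_zone T hLip hP hα hq hq' in
theorem lipschitz_rule_converges [CompleteSpace X] :
    ∃ S : ℕ → Set X, IsTelescopic b g C S (fun _ => μ) ∧ LipschitzOnPieces b f' S ∧
      ProxInZone b b' f f' g S (fun _ => μ) ∧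
      ∀ x₁ ∈ S 1 ∩ zone b, ∃ (L : ℕ → ℝ) (x : ℕ → X), x 1 = x₁ ∧
        IsLipschitzRun b b' f f' g S (fun _ => μ) L x ∧
        ConvergesAlmostSublinearly b b' f g C μ α q x := by
  obtain ⟨S', T', hLip', hP', -, hslow⟩ :=
    exists_slow_telescopic (η := 1) T hLip hP hμ le_rfl hα hq
  refine ⟨S', T', hLip', hP', fun x₁ hx₁ => ?_⟩
  obtain ⟨hpos, hmono, hbd⟩ := pos_bestLip_bound T' hLip'
  have hbreg : ∀ y ∈ C, ∀ z ∈ zone b, bregman b b' y z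
      = (realBregman (fun x => (b x).toReal) b' y z : EReal) :=
    fun y hy z hz => hb.bregman_eq (hC_dom hy) hz
  obtain ⟨x, hx1, hrun, R⟩ := exists_lipschitzRun M T' hbreg hP'
    (Λ := fun k => (bestLip f' (S' k ∩ zone b)).toReal + 1) hpos hmono hbd hx₁
  obtain ⟨y, hy, hgy⟩ := T.proper
  refine ⟨_, x, hx1, hrun, R.convergesAlmostSublinearly M (fun k hk => T'.subset hk)
    ⟨y, T.subset le_rfl hy, hgy⟩ hX hbreg rfl hmin hmin_zone (fun y hy => T'.exists_mem hy) hα hq'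
    ?_⟩
  simpa using hslow

include hX hb hC_dom M hμ hmin hmin_zone T hLip hP hα hq hq' in
theorem backtracking_rule_converges [CompleteSpace X] {η : ℝ} (hη : 1 < η) :
    ∃ S : ℕ → Set X, IsTelescopic b g C S (fun _ => μ) ∧ LipschitzOnPieces b f' S ∧
      ProxInZone b b' f f' g S (fun _ => μ) ∧
      ∀ x₁ ∈ S 1 ∩ zone b, ∃ (L : ℕ → ℝ) (x : ℕ → X), x 1 = x₁ ∧
        IsBacktrackingRun b b' f f' g C η S (fun _ => μ) L x ∧
        ConvergesAlmostSublinearly b b' f g C μ α q x := by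
  have hη0 : 0 < η := zero_lt_one.trans hη
  have hbreg : ∀ y ∈ C, ∀ z ∈ zone b, bregman b b' y z
      = (realBregman (fun x => (b x).toReal) b' y z : EReal) :=
    fun y hy z hz => hb.bregman_eq (hC_dom hy) hz
  have hgp : ∃ y ∈ C, g y < ⊤ := by
    obtain ⟨y, hy, hgy⟩ := T.proper
    exact ⟨y, T.subset le_rfl hy, hgy⟩
  -- Unless all sets equal `C`, the rule demands 0 < L₁ ≤ η L(f', S₁ ∩ U), hence a nonzero Lipschitz
  -- constant on the first set. If the constants vanish on all pieces, the constant sequence `C` is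
  -- used; otherwise the sequence starts at a piece with a nonzero one.
  by_cases h0 : ∀ k, 1 ≤ k → bestLip f' (S k ∩ zone b) = 0
  · obtain ⟨T', hP', hconst⟩ := isTelescopic_const T hP hμ M.closed M.convex hLip h0
    refine ⟨fun _ => C, T', fun k _ => ⟨0, ?_⟩, hP', fun x₁ hx₁ => ?_⟩
    · exact fun x hx y hy => by simp [hconst x hx y hy]
    obtain ⟨L, x, hx1, hrun, R, hL⟩ := exists_backtrackingRun M T' hbreg hP'
      -- Any positive constant bounds the differences of a constant gradient; this one gives L_k ≤
      -- α.
      (Λ := fun _ => α / η) (fun _ _ => le_rfl)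
      (fun k _ x hx y hy => by
        rw [hconst x hx y hy, sub_self, norm_zero]; positivity) hx₁ hη hα
      (mul_div_cancel₀ α hη0.ne').ge (Or.inl fun _ _ => rfl)
    refine ⟨L, x, hx1, hrun, R.convergesAlmostSublinearly M (fun k hk => T'.subset hk) hgp hX hbreg
      rfl hmin hmin_zone (fun y hy => T'.exists_mem hy) hα hq' ?_⟩
    filter_upwards [eventually_ge_atTop 1] with k hk
    refine (hL k hk).trans ?_
    rw [mul_div_cancel₀ α hη0.ne']
    exact le_mul_of_one_le_right hα.le (Real.one_le_rpow (by exact_mod_cast hk) hq.le)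
  · push Not at h0
    obtain ⟨n, hn, hn0⟩ := h0
    obtain ⟨S', T', hLip', hP', hsub, hslow⟩ :=
      exists_slow_telescopic (η := η) T hLip hP hμ hn hα hq
    refine ⟨S', T', hLip', hP', fun x₁ hx₁ => ?_⟩
    obtain ⟨-, hmono, hbd⟩ := pos_bestLip_bound T' hLip'
    have hne : bestLip f' (S' 1 ∩ zone b) ≠ 0 := fun h =>
      hn0 (le_antisymm ((bestLip_mono (inter_subset_inter_left _ hsub)).trans h.le) zero_le)
    have hnt := bestLip_ne_top hLip' le_rfl
    have hL₁ := ENNReal.toReal_pos hne hnt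
    obtain ⟨L, x, hx1, hrun, R, hL⟩ := exists_backtrackingRun M T' hbreg hP'
      (Λ := fun k => (bestLip f' (S' k ∩ zone b)).toReal + 1) hmono hbd hx₁ hη hL₁
      (by nlinarith) (Or.inr (by
        rw [ENNReal.ofReal_toReal hnt]
        exact le_mul_of_one_le_left' (ENNReal.one_le_ofReal.2 hη.le)))
    refine ⟨L, x, hx1, hrun, R.convergesAlmostSublinearly M (fun k hk => T'.subset hk) hgp hX hbreg
      rfl hmin hmin_zone (fun y hy => T'.exists_mem hy) hα hq' ?_⟩
    filter_upwards [hslow, eventually_ge_atTop 1] with k hk hk1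
    exact (hL k hk1).trans hk

end Rules

end TEPROG

/-! ### The main theorem. -/

theorem mainTheorem3 {X : Type*} [NormedAddCommGroup X] [NormedSpace ℝ X] [CompleteSpace X]
    (hX : TEPROG.IsReflexive X)
    (b : X → EReal) (b' : X → X →L[ℝ] ℝ) (hb : TEPROG.IsSemiBregman b b')
    (C : Set X) (hC_dom : C ⊆ TEPROG.dom b) (hC_closed : IsClosed C) (hC_convex : Convex ℝ C)
    (hC_zone : (C ∩ TEPROG.zone b).Nonempty) (hC_nontrivial : C.Nontrivial)
    (f : X → ℝ) (f' : X → X →L[ℝ] ℝ) (f'' : X → X →L[ℝ] X →L[ℝ] ℝ)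
    (hf_convex : ConvexOn ℝ (TEPROG.dom b) f)
    (hf_deriv : ∀ x ∈ TEPROG.zone b, TEPROG.HasGateauxDerivAt f (f' x) x)
    (hf_lsc : LowerSemicontinuousOn f C)
    (g : X → EReal) (hg_bot : ∀ x ∈ C, g x ≠ ⊥) (hg_convex : TEPROG.EConvexOn C g)
    (hg_proper : ∃ x ∈ C, g x < ⊤) (hg_lsc : LowerSemicontinuousOn g C)
    -- the minimizers of the objective exist and lie in the zone
    (hmin : (TEPROG.minimizers C f g).Nonempty)
    (hmin_zone : TEPROG.minimizers C f g ⊆ TEPROG.zone b)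
    -- the proximal points stay in the zone: for all telescopic sequences that may be constructed,
    -- or for one given telescopic sequence
    (hprox :
      (∀ (S : ℕ → Set X) (ν : ℕ → ℝ), TEPROG.IsTelescopic b g C S ν →
          TEPROG.LipschitzOnPieces b f' S → (∃ x ∈ S 1 ∩ TEPROG.zone b, g x < ⊤) →
          TEPROG.ProxInZone b b' f f' g S ν) ∨
      (∃ (S : ℕ → Set X) (ν : ℕ → ℝ), TEPROG.IsTelescopic b g C S ν ∧
          TEPROG.LipschitzOnPieces b f' S ∧ TEPROG.ProxInZone b b' f f' g S ν))
    -- the second derivative of `f`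
    (hf_second : ∀ x ∈ C ∩ TEPROG.zone b, TEPROG.HasGateauxDerivAt f' (f'' x) x)
    (hf_bdd : ∀ D ⊆ C ∩ TEPROG.zone b, Bornology.IsBounded D → ∃ M : ℝ, ∀ x ∈ D, ‖f'' x‖ ≤ M)
    (hf_unif : ∀ D ⊆ C ∩ TEPROG.zone b, Bornology.IsBounded D → UniformContinuousOn f'' D)
    (μ : ℝ) (hμ : TEPROG.StronglyConvexOn C b μ) :
    (∀ q : ℝ, 0 < q → q < 1 → ∀ y₀ ∈ C ∩ TEPROG.zone b, ∀ α : ℝ, ‖f'' y₀‖ < α →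
      -- the Lipschitz step size rule
      (∃ S : ℕ → Set X, TEPROG.IsTelescopic b g C S (fun _ => μ) ∧
        TEPROG.LipschitzOnPieces b f' S ∧ TEPROG.ProxInZone b b' f f' g S (fun _ => μ) ∧
        ∀ x₁ ∈ S 1 ∩ TEPROG.zone b, ∃ (L : ℕ → ℝ) (x : ℕ → X), x 1 = x₁ ∧
          TEPROG.IsLipschitzRun b b' f f' g S (fun _ => μ) L x ∧
          TEPROG.ConvergesAlmostSublinearly b b' f g C μ α q x) ∧
      -- the backtracking step size rule
      (∀ η : ℝ, 1 < η → ∃ S : ℕ → Set X, TEPROG.IsTelescopic b g C S (fun _ => μ) ∧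
        TEPROG.LipschitzOnPieces b f' S ∧ TEPROG.ProxInZone b b' f f' g S (fun _ => μ) ∧
        ∀ x₁ ∈ S 1 ∩ TEPROG.zone b, ∃ (L : ℕ → ℝ) (x : ℕ → X), x 1 = x₁ ∧
          TEPROG.IsBacktrackingRun b b' f f' g C η S (fun _ => μ) L x ∧
          TEPROG.ConvergesAlmostSublinearly b b' f g C μ α q x)) ∧
    (TEPROG.UniformlyConvexOn (TEPROG.zone b) b →
      TEPROG.RelativelyUniformlyConvexFromPoints b C) := by
  have M := hb.isCompositeModel hC_dom hC_closed hC_convex hf_convex hf_deriv hf_lsc hg_bot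
    hg_convex hg_lsc hμ
  obtain ⟨w, hw⟩ := hmin
  have hw' := (M.mem_minimizers_iff hg_proper).1 hw
  -- A minimizer lies in the zone and has finite `g`, so it can be the centre of the balls.
  obtain ⟨S, ν, T, hLip, hP⟩ := TEPROG.exists_telescopic hb hC_dom hC_closed hC_convex
    hC_nontrivial hμ ⟨hw.1, hmin_zone hw⟩ hw'.2.1 hprox hf_second hf_bdd
  refine ⟨fun q hq hq' y₀ _ α hα => ?_, hb.relativelyUniformlyConvexFromPoints hC_dom⟩
  have hα0 : 0 < α := (norm_nonneg (f'' y₀)).trans_lt hα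
  exact ⟨TEPROG.lipschitz_rule_converges hX hb hC_dom M hμ ⟨w, hw⟩ hmin_zone T hLip hP hα0 hq hq',
    fun η hη => TEPROG.backtracking_rule_converges hX hb hC_dom M hμ ⟨w, hw⟩ hmin_zone T hLip hP
      hα0 hq hq' hη⟩
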